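/- **Setting.** For each $k\in\mathbb N$ let $n_1=n_1(k)<n_0=n_0(k)$ be sample sizes with $n_0,n_1\to\infty$; all limits and stochastic orders are as $k\to\infty$. Let $\mathcal P_0,\mathcal P_1$ be fixed probability laws on $\mathbb R^p$ (covariates of the majority class $y=0$ and of the minority class $y=1$) and let $\mathcal P_{\rm syn}=\mathcal P_{{\rm syn},k}$ be a law of synthetic minority covariates that may change with $k$; all these laws are carried by one bounded set $\mathcal X$. Let $\Theta\subseteq\mathbb R^d$ be open and convex and let $\ell(\theta;x,y)$ be a loss, measurable in $x$ and $C^2$ in $\theta\in\Theta$ for $x\in\mathcal X$, such that, over bounded sets of $\theta\in\Theta$ and over $x\in\mathcal X$, $\ell,\nabla\ell,\nabla^2\ell$ are bounded and $\nabla^2\ell$ is uniformly continuous in $\theta$, uniformly in $x$. Assume that $\Theta$ is bounded or that $\ell(\cdot;x,y)$ is convex on $\Theta$ for all $x\in\mathcal X$ and $y$. Put $$\mathcal R(\theta)=\tfrac12\mathbb E_{\mathcal P_0}\ell(\theta;x,0)+\tfrac12\mathbb E_{\mathcal P_1}\ell(\theta;x,1),\quad \phi(\theta)=\mathbb E_{\mathcal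 P_0}\ell(\theta;x,0)-\mathbb E_{\mathcal P_1}\ell(\theta;x,1),\quad \psi(\theta)=\mathbb E_{\mathcal P_{\rm syn}}\ell(\theta;x,1)-\mathbb E_{\mathcal P_1}\ell(\theta;x,1).$$ For a synthetic size $\tilde n$ let $\pi_0,\pi_1,\tilde\pi$ be $n_0,n_1,\tilde n$ divided by $n_0+n_1+\tilde n$, and let $\tilde{\mathcal R}(\theta)=\pi_0\mathbb E_{\mathcal P_0}\ell(\theta;x,0)+\pi_1\mathbb E_{\mathcal P_1}\ell(\theta;x,1)+\tilde\pi\,\mathbb E_{\mathcal P_{\rm syn}}\ell(\theta;x,1)$. From mutually independent samples of $n_0$, $n_1$ and $\tilde n$ covariates, with laws $\mathcal P_0$, $\mathcal P_1$ and $\mathcal P_{\rm syn}$ respectively, let $\hat\theta$ be, with probability tending to one, a minimizer over $\Theta$ of the average loss of the $n_0+n_1+\tilde n$ labelled observations (synthetic ones having label $1$). The size $\tilde n$ may be random, but is independent of the samples. **Assumptions.** (i) $\theta^*\in\Theta$ minimizes $\mathcal R$ over $\Theta$, and for constants $\mu,L>0$ and all $\theta\in\Theta$: $\mathcal R(\theta^*)\ge\mathcal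 R(\theta)+\nabla\mathcal R(\theta)^\top(\theta^*-\theta)+\frac\mu2\|\theta^*-\theta\|^2$ and $\mathcal R(\theta)-\mathcal R(\theta^*)\ge L\|\theta-\theta^*\|^2$. (ii) For each synthetic size considered below there are constants $\lambda>0$ and $\Lambda,L,C$, not depending on $k$, such that with probability tending to one (for all large $k$ if $\tilde n$ is not random) $\tilde{\mathcal R}$ has a minimizer $\tilde\theta$ over $\Theta$ with: $\nabla^2\tilde{\mathcal R}(\theta)\succeq\lambda I$, $\|\nabla^2\tilde{\mathcal R}(\theta)-\nabla^2\tilde{\mathcal R}(\tilde\theta)\|\le L\|\theta-\tilde\theta\|$ and $\|(\pi_0-\frac12)\nabla^2\phi(\theta)+\tilde\pi\nabla^2\psi(\theta)\|\le C$ for all $\theta\in\Theta$; the covariance matrices $\Sigma_0(\tilde\theta),\Sigma_1(\tilde\theta),\tilde\Sigma(\tilde\theta)$ of $\nabla_\theta\ell(\tilde\theta;x,0)$, $\nabla_\theta\ell(\tilde\theta;x,1)$, $\nabla_\theta\ell(\tilde\theta;x,1)$ under $\mathcal P_0,\mathcal P_1,\mathcal P_{\rm syn}$ lie between $\lambda I$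 and $\Lambda I$; and $\Sigma=\pi_0\Sigma_0+\pi_1\Sigma_1+\tilde\pi\tilde\Sigma$ satisfies $\|\Sigma(\tilde\theta)-\Sigma(\theta^*)\|\le L\|\tilde\theta-\theta^*\|$. (iii) Local asymmetry: $\|\nabla\phi(\theta^*)\|\ge c$ for a constant $c>0$; and $\|\nabla^2\psi(\theta^*)\|$ is bounded in $k$. (iv) Realistic generator: $n_0^{-1/2}\ll\|\nabla\psi(\theta^*)\|\ll1$. (v) Alignment: $\sin\angle(\nabla\phi(\theta^*),\nabla\psi(\theta^*))\lesssim\dfrac1{\|\nabla\psi(\theta^*)\|\sqrt{n_0}}$. **Theorem (excess risk under a realistic synthetic generator).** Under these assumptions: (a) If, with probability tending to one, $$\tilde n=\frac{n_0-n_1+O_P(\sqrt{n_0})}{1-2\frac{\|\nabla\psi(\theta^*)\|}{\|\nabla\phi(\theta^*)\|}\cos\angle(\nabla\phi(\theta^*),\nabla\psi(\theta^*))+O_P(n_0^{-1/2})},$$ then $\mathcal R(\hat\theta)-\mathcal R(\theta^*)=\Theta_P(1/n_0)$. (b) If $\tilde n=n_0-n_1$ and the classes stay imbalanced, i.e. $n_1\le\rho\,n_0$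 for all large $k$ with some $\rho<1$, then $\mathcal R(\hat\theta)-\mathcal R(\theta^*)=\Theta_P(\|\nabla\psi(\theta^*)\|^2)$. (c) $1/n_0\ll\|\nabla\psi(\theta^*)\|^2$. -/

import Mathlib

open MeasureTheory ProbabilityTheory Filter Topology Asymptotics

noncomputable section

namespace SynAug

/-- The Euclidean space of dimension `d`. -/
abbrev Euc (d : ℕ) : Type := EuclideanSpace ℝ (Fin d)

/-! ### Stochastic order notation along a sequence of experiments -/

section Stochastic

variable {Ω : Type*} [MeasurableSpace Ω]

/-- The events `A k` hold with probability tending to one (outer probability of the complement,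
so that no measurability is needed). -/
def WithHighProb (μ : Measure Ω) (A : ℕ → Set Ω) : Prop :=
  Tendsto (fun k => μ (A k)ᶜ) atTop (𝓝 0)

/-- `x = O_P(a)`: the ratio `x / a` is stochastically bounded. -/
def IsBigOP (μ : Measure Ω) (x : ℕ → Ω → ℝ) (a : ℕ → ℝ) : Prop :=
  ∀ ε : ℝ, 0 < ε → ∃ C : ℝ, 0 < C ∧
    ∀ᶠ k in atTop, μ {ω | C * a k < |x k ω|} ≤ ENNReal.ofReal ε

/-- `x = Ω_P(a)`: the ratio `x / a` is stochastically bounded away from zero. -/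
def IsBigOmegaP (μ : Measure Ω) (x : ℕ → Ω → ℝ) (a : ℕ → ℝ) : Prop :=
  ∀ ε : ℝ, 0 < ε → ∃ c : ℝ, 0 < c ∧
    ∀ᶠ k in atTop, μ {ω | |x k ω| < c * a k} ≤ ENNReal.ofReal ε

/-- `x = Θ_P(a)`. -/
def IsThetaP (μ : Measure Ω) (x : ℕ → Ω → ℝ) (a : ℕ → ℝ) : Prop :=
  IsBigOP μ x a ∧ IsBigOmegaP μ x a

end Stochastic

/-! ### Calculus and covariance -/

/-- The Hessian of `f` at `θ`, as a linear operator. -/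
def hess {d : ℕ} (f : Euc d → ℝ) (θ : Euc d) : Euc d →L[ℝ] Euc d :=
  fderiv ℝ (gradient f) θ

/-- The Loewner lower bound `c I ⪯ A`, for a self-adjoint operator `A`. -/
def LoewnerGE {d : ℕ} (A : Euc d →L[ℝ] Euc d) (c : ℝ) : Prop :=
  ∀ v : Euc d, c * ‖v‖ ^ 2 ≤ inner ℝ (A v) v

/-- The Loewner upper bound `A ⪯ c I`, for a self-adjoint operator `A`. -/
def LoewnerLE {d : ℕ} (A : Euc d →L[ℝ] Euc d) (c : ℝ) : Prop :=
  ∀ v : Euc d, inner ℝ (A v) v ≤ c * ‖v‖ ^ 2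

/-- The covariance operator `E[(g - E g) (g - E g)ᵀ]` of a random vector `g` under `P`. -/
def covOp {d p : ℕ} (P : Measure (Euc p)) (g : Euc p → Euc d) : Euc d →L[ℝ] Euc d :=
  ∫ x, InnerProductSpace.rankOne ℝ (g x - ∫ z, g z ∂P) (g x - ∫ z, g z ∂P) ∂P

/-! ### The augmented classification problem -/

/-- The data of the problem. The index `k` runs along a sequence of experiments with `n₀ k`
majority and `n₁ k` minority observations; the class-conditional laws `P₀`, `P₁` are fixed, while
the law `Psyn k` of the synthetic generator may change with the sample sizes. -/
structure Model (d p : ℕ) where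
  /-- the parameter space -/
  Θ : Set (Euc d)
  /-- the loss `ℓ(θ; x, y)` -/
  ℓ : Euc d → Euc p → Fin 2 → ℝ
  /-- covariate law of the majority class, `y = 0` -/
  P₀ : Measure (Euc p)
  /-- covariate law of the minority class, `y = 1` -/
  P₁ : Measure (Euc p)
  /-- covariate law of the synthetic minority samples -/
  Psyn : ℕ → Measure (Euc p)
  /-- number of majority observations -/
  n₀ : ℕ → ℕ
  /-- number of minority observations -/
  n₁ : ℕ → ℕ

namespace Model

variable {d p : ℕ} (M : Model d p)

/-- Expected loss of class `y` when the covariates have law `P`. -/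
def classRisk (P : Measure (Euc p)) (y : Fin 2) (θ : Euc d) : ℝ :=
  ∫ x, M.ℓ θ x y ∂P

/-- The balanced population risk `R`. -/
def risk (θ : Euc d) : ℝ :=
  1 / 2 * M.classRisk M.P₀ 0 θ + 1 / 2 * M.classRisk M.P₁ 1 θ

/-- The majority-minority difference `φ`. -/
def φ (θ : Euc d) : ℝ :=
  M.classRisk M.P₀ 0 θ - M.classRisk M.P₁ 1 θ

/-- The synthetic-minority discrepancy `ψ`. -/
def ψ (k : ℕ) (θ : Euc d) : ℝ :=
  M.classRisk (M.Psyn k) 1 θ - M.classRisk M.P₁ 1 θ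

/-- The total sample size with `m` synthetic samples. -/
def total (k m : ℕ) : ℝ := (M.n₀ k : ℝ) + (M.n₁ k : ℝ) + (m : ℝ)

/-- The majority proportion. -/
def π₀ (k m : ℕ) : ℝ := (M.n₀ k : ℝ) / M.total k m

/-- The proportion of real minority samples. -/
def π₁ (k m : ℕ) : ℝ := (M.n₁ k : ℝ) / M.total k m

/-- The proportion of synthetic minority samples. -/
def πsyn (k m : ℕ) : ℝ := (m : ℝ) / M.total k m

/-- The synthetic population risk with `m` synthetic samples. -/
def synRisk (k m : ℕ) (θ : Euc d) : ℝ :=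
  M.π₀ k m * M.classRisk M.P₀ 0 θ + M.π₁ k m * M.classRisk M.P₁ 1 θ
    + M.πsyn k m * M.classRisk (M.Psyn k) 1 θ

/-- Covariance of the loss gradient of class `y` at `θ` under the law `P`. -/
def gradCov (P : Measure (Euc p)) (y : Fin 2) (θ : Euc d) : Euc d →L[ℝ] Euc d :=
  covOp P (fun x => gradient (fun t => M.ℓ t x y) θ)

/-- The pooled covariance `(n₀ Σ₀ + n₁ Σ₁ + m Σsyn) / (n₀ + n₁ + m)` at `θ`. -/
def pooledCov (k m : ℕ) (θ : Euc d) : Euc d →L[ℝ] Euc d :=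
  M.π₀ k m • M.gradCov M.P₀ 0 θ + M.π₁ k m • M.gradCov M.P₁ 1 θ
    + M.πsyn k m • M.gradCov (M.Psyn k) 1 θ

/-- Setting: `n₁ < n₀` and both tend to infinity; all covariate laws are probability measures
carried by one bounded set `𝒳`; the parameter space `Θ` is open and convex; the loss is measurable
in `x` and twice continuously differentiable in `θ`; over bounded sets of `θ ∈ Θ` and over `x ∈ 𝒳`,
the loss, its gradient and its Hessian are bounded and the Hessian is uniformly continuous in `θ`,
uniformly in `x`; and `Θ` is bounded unless the loss is convex in `θ`. -/
structure Setting (𝒳 : Set (Euc p)) : Prop where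
  imbalanced : ∀ k, M.n₁ k < M.n₀ k
  n₁_tendsto : Tendsto M.n₁ atTop atTop
  prob₀ : IsProbabilityMeasure M.P₀
  prob₁ : IsProbabilityMeasure M.P₁
  probSyn : ∀ k, IsProbabilityMeasure (M.Psyn k)
  bounded_support : Bornology.IsBounded 𝒳
  support₀ : ∀ᵐ x ∂M.P₀, x ∈ 𝒳
  support₁ : ∀ᵐ x ∂M.P₁, x ∈ 𝒳
  supportSyn : ∀ k, ∀ᵐ x ∂M.Psyn k, x ∈ 𝒳
  isOpen : IsOpen M.Θ
  convex : Convex ℝ M.Θ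
  bounded_or_convex : Bornology.IsBounded M.Θ ∨
    ∀ x ∈ 𝒳, ∀ y, ConvexOn ℝ M.Θ (fun θ => M.ℓ θ x y)
  measurable_loss : ∀ θ ∈ M.Θ, ∀ y, Measurable (fun x => M.ℓ θ x y)
  contDiff_loss : ∀ x ∈ 𝒳, ∀ y, ContDiffOn ℝ 2 (fun θ => M.ℓ θ x y) M.Θ
  bound_loss : ∀ r : ℝ, ∃ K : ℝ, ∀ θ ∈ M.Θ, ‖θ‖ ≤ r → ∀ x ∈ 𝒳, ∀ y,
    |M.ℓ θ x y| ≤ K ∧ ‖gradient (fun t => M.ℓ t x y) θ‖ ≤ K ∧ ‖hess (fun t => M.ℓ t x y) θ‖ ≤ K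
  hess_uniform : ∀ r ε : ℝ, 0 < ε → ∃ δ : ℝ, 0 < δ ∧
    ∀ θ ∈ M.Θ, ∀ θ' ∈ M.Θ, ‖θ‖ ≤ r → ‖θ'‖ ≤ r → ‖θ - θ'‖ < δ → ∀ x ∈ 𝒳, ∀ y,
      ‖hess (fun t => M.ℓ t x y) θ - hess (fun t => M.ℓ t x y) θ'‖ < ε

/-- `θs` minimizes the balanced risk over the parameter space, where the balanced risk is strongly
convex towards `θs` and grows quadratically away from it. -/
structure BalancedMinimizer (θs : Euc d) : Prop where
  mem : θs ∈ M.Θ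
  isMin : ∀ θ ∈ M.Θ, M.risk θs ≤ M.risk θ
  differentiable : DifferentiableOn ℝ M.risk M.Θ
  strong : ∃ c : ℝ, 0 < c ∧ ∀ θ ∈ M.Θ,
    M.risk θ + inner ℝ (gradient M.risk θ) (θs - θ) + c / 2 * ‖θs - θ‖ ^ 2 ≤ M.risk θs
  growth : ∃ L : ℝ, 0 < L ∧ ∀ θ ∈ M.Θ, L * ‖θ - θs‖ ^ 2 ≤ M.risk θ - M.risk θs

/-- The regularity conditions that involve the synthetic risk with `m` synthetic samples, at its
minimizer `θt`, with constants `lam`, `Lam`, `L`, `C`. -/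
structure RegularAt (θs : Euc d) (lam Lam L C : ℝ) (k m : ℕ) (θt : Euc d) : Prop where
  mem : θt ∈ M.Θ
  isMin : ∀ θ ∈ M.Θ, M.synRisk k m θt ≤ M.synRisk k m θ
  hess_ge : ∀ θ ∈ M.Θ, LoewnerGE (hess (M.synRisk k m) θ) lam
  hess_lip : ∀ θ ∈ M.Θ,
    ‖hess (M.synRisk k m) θ - hess (M.synRisk k m) θt‖ ≤ L * ‖θ - θt‖
  cov₀_ge : LoewnerGE (M.gradCov M.P₀ 0 θt) lam
  cov₁_ge : LoewnerGE (M.gradCov M.P₁ 1 θt) lam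
  covSyn_ge : LoewnerGE (M.gradCov (M.Psyn k) 1 θt) lam
  cov₀_le : LoewnerLE (M.gradCov M.P₀ 0 θt) Lam
  cov₁_le : LoewnerLE (M.gradCov M.P₁ 1 θt) Lam
  covSyn_le : LoewnerLE (M.gradCov (M.Psyn k) 1 θt) Lam
  cov_lip : ‖M.pooledCov k m θt - M.pooledCov k m θs‖ ≤ L * ‖θt - θs‖
  bias_jacobian : ∀ θ ∈ M.Θ,
    ‖(M.π₀ k m - 1 / 2) • hess M.φ θ + M.πsyn k m • hess (M.ψ k) θ‖ ≤ C

/-- The (possibly random) synthetic sizes `nt k` satisfy the regularity conditions with fixed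
constants, with probability tending to one (that is, for all large `k` if they are not random). -/
def Regular {Ω : Type*} [MeasurableSpace Ω] (μ : Measure Ω) (θs : Euc d) (nt : ℕ → Ω → ℕ) : Prop :=
  ∃ lam Lam L C : ℝ, 0 < lam ∧
    WithHighProb μ (fun k => {ω | ∃ θt, M.RegularAt θs lam Lam L C k (nt k ω) θt})

/-- Local asymmetry at `θs`. -/
def LocalAsymmetry (θs : Euc d) : Prop :=
  ∃ c : ℝ, 0 < c ∧ c ≤ ‖gradient M.φ θs‖

/-- A realistic generator: `n₀ ^ (-1/2) ≪ ‖∇ψ(θs)‖ ≪ 1`. -/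
def RealisticGenerator (θs : Euc d) : Prop :=
  (fun k => 1 / √(M.n₀ k : ℝ)) =o[atTop] (fun k => ‖gradient (M.ψ k) θs‖) ∧
    Tendsto (fun k => ‖gradient (M.ψ k) θs‖) atTop (𝓝 0)

/-- The angle between `∇φ(θs)` and `∇ψ(θs)`. -/
def biasAngle (θs : Euc d) (k : ℕ) : ℝ :=
  InnerProductGeometry.angle (gradient M.φ θs) (gradient (M.ψ k) θs)

/-- The alignment condition `sin ∠(∇φ(θs), ∇ψ(θs)) ≲ 1 / (‖∇ψ(θs)‖ √n₀)`. -/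
def Aligned (θs : Euc d) : Prop :=
  (fun k => Real.sin (M.biasAngle θs k)) =O[atTop]
    (fun k => 1 / (‖gradient (M.ψ k) θs‖ * √(M.n₀ k : ℝ)))

/-- The bias-cancelling synthetic size
`(n₀ - n₁ + O_P(√n₀)) / (1 - 2 (‖∇ψ(θs)‖ / ‖∇φ(θs)‖) cos ∠ + O_P(1 / √n₀))`. -/
def BiasCancelling {Ω : Type*} [MeasurableSpace Ω] (μ : Measure Ω) (θs : Euc d)
    (nt : ℕ → Ω → ℕ) : Prop :=
  ∃ U V : ℕ → Ω → ℝ,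
    IsBigOP μ U (fun k => √(M.n₀ k : ℝ)) ∧
    IsBigOP μ V (fun k => 1 / √(M.n₀ k : ℝ)) ∧
    WithHighProb μ (fun k => {ω | (nt k ω : ℝ) =
      ((M.n₀ k : ℝ) - (M.n₁ k : ℝ) + U k ω) /
        (1 - 2 * (‖gradient (M.ψ k) θs‖ / ‖gradient M.φ θs‖) * Real.cos (M.biasAngle θs k)
          + V k ω)})

/-- The samples of the experiments: for every `k`, mutually independent sequences of majority,
minority and synthetic covariates, with laws `P₀`, `P₁` and `Psyn k`. Experiment `k` uses the first
`n₀ k`, the first `n₁ k` and the first `m` of them, respectively. -/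
structure Samples {Ω : Type*} [MeasurableSpace Ω] (μ : Measure Ω) where
  X₀ : ℕ → ℕ → Ω → Euc p
  X₁ : ℕ → ℕ → Ω → Euc p
  Xsyn : ℕ → ℕ → Ω → Euc p
  measurable₀ : ∀ k i, Measurable (X₀ k i)
  measurable₁ : ∀ k i, Measurable (X₁ k i)
  measurableSyn : ∀ k i, Measurable (Xsyn k i)
  law₀ : ∀ k i, μ.map (X₀ k i) = M.P₀
  law₁ : ∀ k i, μ.map (X₁ k i) = M.P₁
  lawSyn : ∀ k i, μ.map (Xsyn k i) = M.Psyn k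
  indep : ∀ k, iIndepFun (Sum.elim (X₀ k) (Sum.elim (X₁ k) (Xsyn k))) μ

variable {M} {Ω : Type*} [MeasurableSpace Ω] {μ : Measure Ω}

/-- The empirical augmented risk with `m` synthetic samples. -/
def Samples.empRisk (S : M.Samples μ) (k m : ℕ) (ω : Ω) (θ : Euc d) : ℝ :=
  1 / M.total k m *
    (∑ i ∈ Finset.range (M.n₀ k), M.ℓ θ (S.X₀ k i ω) 0
      + ∑ i ∈ Finset.range (M.n₁ k), M.ℓ θ (S.X₁ k i ω) 1
      + ∑ i ∈ Finset.range m, M.ℓ θ (S.Xsyn k i ω) 1)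

/-- The synthetic sizes `nt k` are random variables independent of the samples (in particular, they
may be deterministic). -/
def Samples.IndependentSize (S : M.Samples μ) (nt : ℕ → Ω → ℕ) : Prop :=
  ∀ k, Measurable (nt k) ∧
    IndepFun (nt k)
      (fun ω (s : ℕ ⊕ ℕ ⊕ ℕ) => Sum.elim (S.X₀ k) (Sum.elim (S.X₁ k) (S.Xsyn k)) s ω) μ

/-- With probability tending to one, `θhat k` minimizes over the parameter space the empirical
augmented risk with `nt k` synthetic samples. -/
def Samples.IsERM (S : M.Samples μ) (nt : ℕ → Ω → ℕ) (θhat : ℕ → Ω → Euc d) : Prop :=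
  WithHighProb μ (fun k => {ω | θhat k ω ∈ M.Θ ∧
    ∀ θ ∈ M.Θ, S.empRisk k (nt k ω) ω (θhat k ω) ≤ S.empRisk k (nt k ω) ω θ})

end Model

end SynAug

end

/-! The excess risk is governed by one random vector, the empirical augmented gradient `g` at the
balanced minimizer `θs`. Near `θs` the empirical risk is strongly convex with Lipschitz gradient, so
the distance from `θhat` to `θs` is of exact order `‖g‖`. The balanced risk has quadratic growth and
bounded Hessian there, so the excess risk is of exact order `‖g‖²` (`Samples.excess_comparable`).
Everything is expanded at `θs` itself; the minimizer `θt` of the synthetic risk serves only to carry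
nondegeneracy over to `θs`.

It remains to size `g = bias + noise`. The balanced gradient vanishes at `θs`, so the bias equals
`(π₀ - 1/2) ∇φ + πsyn ∇ψ`. The noise is `O_P(n₀^(-1/2))` by Chebyshev, uniformly in the synthetic
size, so an independent random size is harmless.

In (a), the prescribed size cancels the component of the bias along `∇φ` up to `O_P(n₀^(-1/2))`. The
orthogonal component is at most `‖∇ψ‖ sin ∠`, which alignment makes `O(n₀^(-1/2))` (`norm_bias_le`,
`BiasCancelling.bias_tail`). For the lower bound, `g` must not concentrate near zero, whatever the
bias. The sum of all gradients, projected on a unit vector, contains `n₀` independent terms of one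
fixed nondegenerate law. Its characteristic function is therefore dominated by the `n₀`-th power of
a fixed one, and a Gaussian-averaged Fourier inequality bounds the mass of small balls at scale
`√n₀` (`exists_small_ball`, `Samples.exists_anticoncentration`). Only the fixed law `P₀` matters, so
no central limit theorem for varying generators is needed.

In (b), `π₀ = 1/2` exactly, and the bias is `∇ψ` times a factor bounded away from zero by the
imbalance. Since `‖∇ψ‖ ≫ n₀^(-1/2)`, it dominates the noise. Squaring that relation is (c). -/

noncomputable section

namespace SynAug

/-! ### Convexity from Hessian bounds; two general tools. -/

section StrongConvexity

variable {E : Type*} [NormedAddCommGroup E] [InnerProductSpace ℝ E] [CompleteSpace E]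

/-- A lower bound on the Hessian gives a quadratic lower bound on the function. -/
theorem quadratic_lower_bound {s : Set E} (hs : Convex ℝ s) {f : E → ℝ} {g : E → E}
    {H : E → E →L[ℝ] E} (hf : ∀ x ∈ s, HasGradientAt f (g x) x)
    (hg : ∀ x ∈ s, HasFDerivAt g (H x) x) {c : ℝ}
    (hH : ∀ x ∈ s, ∀ v, c * ‖v‖ ^ 2 ≤ inner ℝ (H x v) v) {x y : E} (hx : x ∈ s) (hy : y ∈ s) :
    f x + inner ℝ (g x) (y - x) + c / 2 * ‖y - x‖ ^ 2 ≤ f y := by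
  set v := y - x with hv
  have hmem : ∀ t ∈ Set.Icc (0 : ℝ) 1, x + t • v ∈ s := fun t ht =>
    hs.add_smul_sub_mem hx hy ht
  have hline : ∀ t : ℝ, HasDerivAt (fun t : ℝ => x + t • v) v t := fun t => by
    simpa using ((hasDerivAt_id t).smul_const v).const_add x
  -- Monotonicity is used twice on the segment: the slope minus `c ‖v‖² t` is nondecreasing, hence
  -- so is the second-order remainder in `hw`. Neither continuity of `H` nor a sign of `c` is
  -- needed; a negative `c` later yields an upper bound.
  have hu : ∀ t ∈ Set.Icc (0 : ℝ) 1, HasDerivAt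
      (fun t : ℝ => inner ℝ (g (x + t • v)) v - c * ‖v‖ ^ 2 * t)
      (inner ℝ (H (x + t • v) v) v - c * ‖v‖ ^ 2) t := fun t ht => by
    have h1 := (hg _ (hmem t ht)).comp_hasDerivAt t (hline t)
    have h2 := h1.inner ℝ (hasDerivAt_const t v)
    have h3 := h2.sub ((hasDerivAt_id t).const_mul (c * ‖v‖ ^ 2))
    convert! h3 using 1
    simp
  have hmono : MonotoneOn (fun t : ℝ => inner ℝ (g (x + t • v)) v - c * ‖v‖ ^ 2 * t)
      (Set.Icc 0 1) := by
    apply monotoneOn_of_deriv_nonneg (convex_Icc 0 1)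
      (fun t ht => (hu t ht).continuousAt.continuousWithinAt)
    · intro t ht
      exact (hu t (interior_subset ht)).differentiableAt.differentiableWithinAt
    · intro t ht
      rw [(hu t (interior_subset ht)).deriv]
      linarith [hH _ (hmem t (interior_subset ht)) v]
  have hw : ∀ t ∈ Set.Icc (0 : ℝ) 1, HasDerivAt
      (fun t : ℝ => f (x + t • v) - t * inner ℝ (g x) v - c / 2 * ‖v‖ ^ 2 * t ^ 2)
      (inner ℝ (g (x + t • v)) v - inner ℝ (g x) v - c * ‖v‖ ^ 2 * t) t := fun t ht => by
    have h1 := (hf _ (hmem t ht)).hasFDerivAt.comp_hasDerivAt t (hline t)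
    have h2 := (h1.sub ((hasDerivAt_id t).mul_const (inner ℝ (g x) v))).sub
      ((hasDerivAt_pow 2 t).const_mul (c / 2 * ‖v‖ ^ 2))
    convert! h2 using 1
    simp
    ring
  have hmono2 : MonotoneOn
      (fun t : ℝ => f (x + t • v) - t * inner ℝ (g x) v - c / 2 * ‖v‖ ^ 2 * t ^ 2)
      (Set.Icc 0 1) := by
    apply monotoneOn_of_deriv_nonneg (convex_Icc 0 1)
      (fun t ht => (hw t ht).continuousAt.continuousWithinAt)
    · intro t ht
      exact (hw t (interior_subset ht)).differentiableAt.differentiableWithinAt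
    · intro t ht
      have ht' := interior_subset ht
      rw [(hw t ht').deriv]
      have := hmono (Set.left_mem_Icc.2 zero_le_one) ht' ht'.1
      simp only [zero_smul, add_zero, mul_zero, sub_zero] at this
      linarith
  have := hmono2 (Set.left_mem_Icc.2 zero_le_one) (Set.right_mem_Icc.2 zero_le_one) zero_le_one
  simp only [zero_smul, add_zero, one_smul] at this
  have hxy : x + v = y := by simp [hv]
  rw [hxy] at this
  linarith

end StrongConvexity

/-- The norm of a finite-dimensional space is controlled by finitely many functionals. -/
theorem exists_functionals_norm_le (E : Type*) [NormedAddCommGroup E] [NormedSpace ℝ E]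
    [FiniteDimensional ℝ E] : ∃ (n : ℕ) (L : Fin n → E →L[ℝ] ℝ) (C : ℝ), 0 < C ∧
      ∀ (v : E) (t : ℝ), (∀ i, |L i v| ≤ t) → 0 ≤ t → ‖v‖ ≤ C * t := by
  let b := Module.finBasis ℝ E
  -- The summand 1 keeps the constant positive in dimension zero.
  refine ⟨_, fun i => LinearMap.toContinuousLinearMap (b.coord i), 1 + ∑ i, ‖b i‖, by positivity,
    fun v t h ht => ?_⟩
  calc ‖v‖ = ‖∑ i, b.repr v i • b i‖ := by rw [b.sum_repr]
    _ ≤ ∑ i, ‖b.repr v i • b i‖ := norm_sum_le _ _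
    _ ≤ ∑ i, t * ‖b i‖ := by
        gcongr with i
        rw [norm_smul]
        gcongr
        exact h i
    _ ≤ (1 + ∑ i, ‖b i‖) * t := by rw [← Finset.mul_sum]; linarith

/-- A bound that is uniform in a deterministic index transfers to an independent random index. -/
theorem measure_random_index_le {Ω β : Type*} [MeasurableSpace Ω] [MeasurableSpace β]
    {μ : Measure Ω} [IsProbabilityMeasure μ] {nt : Ω → ℕ} {Y : Ω → β} (hnt : Measurable nt)
    (h : IndepFun nt Y μ) {B : ℕ → Set β} (hB : ∀ m, MeasurableSet (B m)) {ε : ENNReal}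
    (hle : ∀ m, μ (Y ⁻¹' B m) ≤ ε) : μ {ω | Y ω ∈ B (nt ω)} ≤ ε := by
  have hsub : {ω | Y ω ∈ B (nt ω)} = ⋃ m, (nt ⁻¹' {m} ∩ Y ⁻¹' B m) := by
    ext ω; simp
  calc μ {ω | Y ω ∈ B (nt ω)} ≤ ∑' m, μ (nt ⁻¹' {m} ∩ Y ⁻¹' B m) := by
        rw [hsub]; exact measure_iUnion_le _
    _ = ∑' m, μ (nt ⁻¹' {m}) * μ (Y ⁻¹' B m) := by
        congr 1; ext m
        exact h.measure_inter_preimage_eq_mul _ _ (measurableSet_singleton m) (hB m)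
    _ ≤ ∑' m, μ (nt ⁻¹' {m}) * ε := by
        gcongr with m; exact hle m
    _ = (∑' m, μ (nt ⁻¹' {m})) * ε := ENNReal.tsum_mul_right
    _ = μ (⋃ m, nt ⁻¹' {m}) * ε := by
        rw [measure_iUnion (fun i j hij => Disjoint.preimage _ (by simpa using hij))
          (fun m => hnt (measurableSet_singleton m))]
    _ ≤ 1 * ε := by gcongr; exact prob_le_one
    _ = ε := one_mul _

/-! ### Small-ball estimates through characteristic functions. -/

section AntiConcentration

/-- Small-ball bound in terms of a Gaussian average of the characteristic function. -/
theorem measure_abs_le_charFun (ρ : Measure ℝ) [IsProbabilityMeasure ρ] {a : ℝ} (ha : 0 < a) :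
    ρ.real {x | |x| ≤ a} ≤
      Real.exp (1 / 2) * ∫ z, ‖charFun ρ (a⁻¹ * z)‖ ∂(gaussianReal 0 1) := by
  -- The kernel `exp(-u²/2)` is the characteristic function of the standard Gaussian, so Fubini
  -- turns its `ρ`-integral into a Gaussian average of `charFun ρ`.
  have key : ∫ x, Complex.exp (-((a⁻¹ * x : ℝ) : ℂ) ^ 2 / 2) ∂ρ =
      ∫ z, charFun ρ (a⁻¹ * z) ∂(gaussianReal 0 1) := by
    have h1 : ∀ x : ℝ, Complex.exp (-((a⁻¹ * x : ℝ) : ℂ) ^ 2 / 2) =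
        ∫ z, Complex.exp ((a⁻¹ * z * x : ℝ) * Complex.I) ∂(gaussianReal 0 1) := by
      intro x
      have := charFun_gaussianReal (μ := 0) (v := 1) (a⁻¹ * x)
      rw [charFun_apply_real] at this
      trans Complex.exp (((a⁻¹ * x : ℝ) : ℂ) * (0 : ℝ) * Complex.I - (1 : NNReal) *
          ((a⁻¹ * x : ℝ) : ℂ) ^ 2 / 2)
      · congr 1; push_cast; ring
      · rw [← this]
        congr 1; ext z; congr 1; push_cast; ring
    simp_rw [h1, charFun_apply_real]
    rw [integral_integral_swap]
    · congr 1; ext z; congr 1; ext x; congr 1; push_cast; ring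
    · refine Integrable.of_bound (C := 1) ?_ ?_
      · apply Continuous.aestronglyMeasurable
        fun_prop
      · filter_upwards with p
        simp only [Function.uncurry]
        rw [Complex.norm_exp_ofReal_mul_I]
  have hint : Integrable (fun x : ℝ => Real.exp (-(a⁻¹ * x) ^ 2 / 2)) ρ := by
    refine Integrable.of_bound (C := 1) (by fun_prop) ?_
    filter_upwards with x
    rw [Real.norm_eq_abs, abs_of_pos (Real.exp_pos _), Real.exp_le_one_iff]
    have := sq_nonneg (a⁻¹ * x)
    linarith
  have h2 : ∫ x, Real.exp (-(a⁻¹ * x) ^ 2 / 2) ∂ρ ≤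
      ∫ z, ‖charFun ρ (a⁻¹ * z)‖ ∂(gaussianReal 0 1) := by
    have h3 : ((∫ x, Real.exp (-(a⁻¹ * x) ^ 2 / 2) ∂ρ : ℝ) : ℂ) =
        ∫ x, Complex.exp (-((a⁻¹ * x : ℝ) : ℂ) ^ 2 / 2) ∂ρ := by
      rw [← integral_complex_ofReal]
      congr 1; ext x; push_cast; rfl
    calc ∫ x, Real.exp (-(a⁻¹ * x) ^ 2 / 2) ∂ρ
        ≤ ‖((∫ x, Real.exp (-(a⁻¹ * x) ^ 2 / 2) ∂ρ : ℝ) : ℂ)‖ := by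
          rw [Complex.norm_real]; exact le_abs_self _
      _ = ‖∫ z, charFun ρ (a⁻¹ * z) ∂(gaussianReal 0 1)‖ := by rw [h3, key]
      _ ≤ _ := norm_integral_le_integral_norm _
  have hmeas : MeasurableSet {x : ℝ | |x| ≤ a} :=
    measurableSet_le measurable_id.abs measurable_const
  calc ρ.real {x | |x| ≤ a} = ∫ x, Set.indicator {x | |x| ≤ a} (fun _ => (1 : ℝ)) x ∂ρ := by
        rw [integral_indicator_const _ hmeas]; simp
    -- On `|x| ≤ a` the kernel is at least `exp(-1/2)`, whence the factor `exp(1/2)`.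
    _ ≤ ∫ x, Real.exp (1 / 2) * Real.exp (-(a⁻¹ * x) ^ 2 / 2) ∂ρ := by
        refine integral_mono ((integrable_const _).indicator hmeas) (hint.const_mul _) fun x => ?_
        by_cases hx : |x| ≤ a
        · simp only [Set.indicator, Set.mem_ofPred_eq, hx, if_true]
          rw [← Real.exp_add]
          apply Real.one_le_exp
          have : |a⁻¹ * x| ≤ 1 := by
            rw [abs_mul, abs_of_pos (inv_pos.2 ha), inv_mul_le_iff₀ ha]; simpa
          have := (sq_le_one_iff_abs_le_one _).2 this
          linarith
        · simp only [Set.indicator, Set.mem_ofPred_eq, hx, if_false]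
          positivity
    _ ≤ _ := by
        rw [integral_const_mul]
        gcongr

/-- This is the central limit theorem for characteristic functions, applied to the standardized
variable. Taking moduli removes the phase produced by the mean, so `ν` need not be centred. -/
theorem tendsto_norm_charFun_pow (ν : Measure ℝ) [IsProbabilityMeasure ν]
    (hv : Var[id; ν] ≠ 0) (t : ℝ) :
    Tendsto (fun n : ℕ => ‖charFun ν ((√n)⁻¹ * t)‖ ^ n) atTop
      (𝓝 (Real.exp (-(Var[id; ν] * t ^ 2) / 2))) := by
  -- Outside L² the extended variance is infinite and the real variance defaults to zero, so `hv`
  -- contains square integrability.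
  have hL2 : MemLp id 2 ν := memLp_two_of_variance_ne_zero aestronglyMeasurable_id hv
  have hint : Integrable (id : ℝ → ℝ) ν := hL2.integrable (by norm_num)
  set σ := √(Var[id; ν]) with hσ
  have hvpos : 0 < Var[id; ν] := lt_of_le_of_ne (variance_nonneg _ _) hv.symm
  have hσpos : 0 < σ := Real.sqrt_pos.2 hvpos
  set m := ∫ x, id x ∂ν with hm
  let X : ℝ → ℝ := fun x => σ⁻¹ * (x - m)
  have h0 : ν[X] = 0 := by
    simp only [X]
    have : ∫ x, (x - m) ∂ν = ∫ x, id x ∂ν - ∫ _, m ∂ν := integral_sub hint (integrable_const _)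
    rw [integral_const_mul, this]
    simp [hm]
  have h1 : ν[X ^ 2] = 1 := by
    have : Var[id; ν] = ∫ x, (x - m) ^ 2 ∂ν := variance_eq_integral measurable_id.aemeasurable
    simp only [X, Pi.pow_apply, mul_pow]
    rw [integral_const_mul, ← this, inv_pow, hσ, Real.sq_sqrt hvpos.le, inv_mul_cancel₀ hv]
  have hX : AEMeasurable X ν := by fun_prop
  have hchar : ∀ s : ℝ, ‖charFun (ν.map X) (σ * s)‖ = ‖charFun ν s‖ := by
    intro s
    have : ν.map X = ((ν.map (fun x => x + (-m))).map (fun x => σ⁻¹ * x)) := by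
      rw [Measure.map_map (by fun_prop) (by fun_prop)]; rfl
    rw [this, charFun_map_mul, charFun_map_add_const, norm_mul, ← mul_assoc,
      inv_mul_cancel₀ hσpos.ne', one_mul]
    have : ‖Complex.exp ((inner ℝ (-m) s : ℝ) * Complex.I)‖ = 1 := Complex.norm_exp_ofReal_mul_I _
    rw [this, mul_one]
  have := (tendsto_charFun_inv_sqrt_mul_pow hX h0 h1 (σ * t)).norm
  simp only [norm_pow] at this
  convert! this using 2
  · rename_i n
    rw [← hchar]; congr 3; ring
  · rw [← Complex.ofReal_pow, ← Complex.ofReal_neg]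
    have : ((-(σ * t) ^ 2 : ℝ) : ℂ) / 2 = ((-(σ * t) ^ 2 / 2 : ℝ) : ℂ) := by push_cast; rfl
    rw [this, Complex.norm_exp_ofReal, mul_pow, hσ, Real.sq_sqrt hvpos.le]

/-- Anti-concentration at the scale `√n` of a law whose characteristic function is dominated by the
`n`-th power of that of a fixed non-degenerate law. -/
theorem exists_small_ball (ν : Measure ℝ) [IsProbabilityMeasure ν] (hv : Var[id; ν] ≠ 0)
    {ε : ℝ} (hε : 0 < ε) : ∃ c : ℝ, 0 < c ∧ ∀ᶠ n : ℕ in atTop,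
      ∀ (ρ : Measure ℝ) [IsProbabilityMeasure ρ], (∀ t, ‖charFun ρ t‖ ≤ ‖charFun ν t‖ ^ n) →
        ρ.real {x | |x| ≤ c * √n} ≤ ε := by
  have hvpos : 0 < Var[id; ν] := lt_of_le_of_ne (variance_nonneg _ _) hv.symm
  -- The radius is `c = 1/(j+1)`. The expressions here are the limits as `n → ∞` of the Fourier
  -- bounds at radius `c √n`; they vanish as `j → ∞` because `z ≠ 0` almost surely, so some `j`
  -- brings the limit below `ε`.
  have hlim : Tendsto (fun j : ℕ => Real.exp (1 / 2) *
      ∫ z, Real.exp (-(Var[id; ν] * ((j + 1 : ℝ) * z) ^ 2) / 2) ∂(gaussianReal 0 1)) atTop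
      (𝓝 (Real.exp (1 / 2) * ∫ _, (0 : ℝ) ∂(gaussianReal 0 1))) := by
    refine Tendsto.const_mul _ (tendsto_integral_of_dominated_convergence (fun _ => 1)
      (fun j => by fun_prop) (integrable_const _) (fun j => ?_) ?_)
    · filter_upwards with z
      rw [Real.norm_eq_abs, abs_of_pos (Real.exp_pos _), Real.exp_le_one_iff]
      have : 0 ≤ Var[id; ν] * ((j + 1 : ℝ) * z) ^ 2 := by positivity
      linarith
    · have : ∀ᵐ z ∂(gaussianReal 0 1), z ≠ 0 := by
        have := nullSingletonClass_gaussianReal (μ := 0) (v := 1) one_ne_zero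
        simp [ae_iff]
      filter_upwards [this] with z hz
      refine Real.tendsto_exp_atBot.comp ?_
      have h1 : Tendsto (fun j : ℕ => ((j : ℝ) + 1) ^ 2) atTop atTop :=
        (tendsto_pow_atTop two_ne_zero).comp
          (tendsto_atTop_add_const_right _ _ tendsto_natCast_atTop_atTop)
      have hneg : -(Var[id; ν] * z ^ 2 / 2) < 0 := by
        have : 0 < Var[id; ν] * z ^ 2 := by positivity
        linarith
      refine (h1.const_mul_atTop_of_neg hneg).congr fun j => ?_
      ring
  simp only [integral_zero, mul_zero] at hlim
  obtain ⟨j, hj⟩ := (hlim.eventually (gt_mem_nhds hε)).exists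
  have hjpos : (0 : ℝ) < j + 1 := by positivity
  refine ⟨(j + 1 : ℝ)⁻¹, inv_pos.2 hjpos, ?_⟩
  -- With `j` fixed, the threshold on `n` depends on `ν` only; this makes the final bound uniform
  -- over `ρ`.
  have hlim2 : Tendsto (fun n : ℕ => Real.exp (1 / 2) *
      ∫ z, ‖charFun ν ((√n)⁻¹ * ((j + 1 : ℝ) * z))‖ ^ n ∂(gaussianReal 0 1)) atTop
      (𝓝 (Real.exp (1 / 2) *
        ∫ z, Real.exp (-(Var[id; ν] * ((j + 1 : ℝ) * z) ^ 2) / 2) ∂(gaussianReal 0 1))) := by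
    refine Tendsto.const_mul _ (tendsto_integral_of_dominated_convergence (fun _ => 1)
      (fun n => ?_) (integrable_const _) (fun n => ?_) ?_)
    · have : Measurable (charFun ν) := measurable_charFun
      exact ((this.comp (by fun_prop)).norm.pow_const n).aestronglyMeasurable
    · filter_upwards with z
      rw [Real.norm_eq_abs, abs_of_nonneg (by positivity)]
      exact pow_le_one₀ (norm_nonneg _) (norm_charFun_le_one _)
    · filter_upwards with z
      exact tendsto_norm_charFun_pow ν hv _
  filter_upwards [hlim2.eventually (gt_mem_nhds hj), eventually_gt_atTop 0] with n hn hn0 ρ _ hρ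
  have hn0' : (0 : ℝ) < √n := Real.sqrt_pos.2 (by exact_mod_cast hn0)
  refine (measure_abs_le_charFun ρ (a := (j + 1 : ℝ)⁻¹ * √n) (by positivity)).trans
    (le_trans (mul_le_mul_of_nonneg_left ?_ (Real.exp_pos _).le) hn.le)
  refine integral_mono_of_nonneg (ae_of_all _ fun z => norm_nonneg _) ?_
    (ae_of_all _ fun z => ?_)
  · refine Integrable.of_bound (C := 1) ?_ (ae_of_all _ fun z => ?_)
    · have : Measurable (charFun ν) := measurable_charFun
      exact ((this.comp (by fun_prop)).norm.pow_const n).aestronglyMeasurable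
    · rw [Real.norm_eq_abs, abs_of_nonneg (by positivity)]
      exact pow_le_one₀ (norm_nonneg _) (norm_charFun_le_one _)
  · refine (hρ _).trans (le_of_eq ?_)
    congr 3
    rw [mul_inv, inv_inv]; ring

end AntiConcentration

/-! ### Differentiation of the class risks. -/

/-- Differentiation under the integral sign, with locally bounded derivatives on an open set. -/
theorem aestronglyMeasurable_and_hasFDerivAt_integral {d p : ℕ} {F : Type*} [NormedAddCommGroup F]
    [NormedSpace ℝ F] {Θ : Set (Euc d)} (hΘ : IsOpen Θ) {𝒳 : Set (Euc p)}
    {P : Measure (Euc p)} [IsProbabilityMeasure P] (hP : ∀ᵐ x ∂P, x ∈ 𝒳)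
    {G : Euc d → Euc p → F} {G' : Euc d → Euc p → Euc d →L[ℝ] F}
    (hmeas : ∀ θ ∈ Θ, AEStronglyMeasurable (G θ) P)
    (hdiff : ∀ θ ∈ Θ, ∀ x ∈ 𝒳, HasFDerivAt (fun t => G t x) (G' θ x) θ)
    (hb : ∀ r : ℝ, ∃ K : ℝ, ∀ θ ∈ Θ, ‖θ‖ ≤ r → ∀ x ∈ 𝒳, ‖G θ x‖ ≤ K ∧ ‖G' θ x‖ ≤ K)
    {θ : Euc d} (hθ : θ ∈ Θ) :
    AEStronglyMeasurable (G' θ) P ∧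
      HasFDerivAt (fun t => ∫ x, G t x ∂P) (∫ x, G' θ x ∂P) θ := by
  -- Measurability of `G'` is derived, not assumed: directional derivatives are limits of difference
  -- quotients, with indices shifted by `N` so that the points stay in `Θ`. Finitely many directions
  -- then determine the operator.
  have hdir : ∀ v : Euc d, AEStronglyMeasurable (fun x => G' θ x v) P := by
    intro v
    have hlim : Tendsto (fun n : ℕ => θ + (n : ℝ)⁻¹ • v) atTop (𝓝 θ) := by
      have : Tendsto (fun n : ℕ => θ + (n : ℝ)⁻¹ • v) atTop (𝓝 (θ + (0 : ℝ) • v)) :=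
        (tendsto_inv_atTop_nhds_zero_nat.smul_const v).const_add θ
      simpa using this
    obtain ⟨N, hN⟩ := eventually_atTop.1 (hlim.eventually (hΘ.mem_nhds hθ))
    refine aestronglyMeasurable_of_tendsto_ae atTop
      (f := fun n x => ((n + N : ℕ) : ℝ) • (G (θ + ((n + N : ℕ) : ℝ)⁻¹ • v) x - G θ x))
      (fun n => ?_) ?_
    · exact ((hmeas _ (hN _ (Nat.le_add_left _ _))).sub (hmeas _ hθ)).const_smul _
    · filter_upwards [hP] with x hx
      refine (hdiff θ hθ x hx).lim v (c := fun n : ℕ => ((n + N : ℕ) : ℝ)) ?_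
      simp only [Real.norm_natCast]
      exact tendsto_natCast_atTop_atTop.comp (tendsto_add_atTop_nat N)
  have hm : AEStronglyMeasurable (G' θ) P := by
    have hrep : ∀ x, G' θ x = ∑ i, ContinuousLinearMap.smulRightL ℝ (Euc d) F
        (EuclideanSpace.proj i) (G' θ x (EuclideanSpace.single i 1)) := by
      intro x
      ext v
      have hv : v = ∑ i, v i • EuclideanSpace.single i (1 : ℝ) := by
        simpa using ((EuclideanSpace.basisFun (Fin d) ℝ).sum_repr v).symm
      conv_lhs => rw [hv]
      simp [map_sum]
    rw [show G' θ = fun x => ∑ i, ContinuousLinearMap.smulRightL ℝ (Euc d) F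
        (EuclideanSpace.proj i) (G' θ x (EuclideanSpace.single i 1)) from funext hrep]
    refine Finset.aestronglyMeasurable_fun_sum _ fun i _ => ?_
    exact (ContinuousLinearMap.continuous _).comp_aestronglyMeasurable (hdir _)
  refine ⟨hm, ?_⟩
  obtain ⟨s, hs, hsub⟩ := Metric.isOpen_iff.1 hΘ θ hθ
  obtain ⟨K, hK⟩ := hb (‖θ‖ + s)
  have hnorm : ∀ t ∈ Metric.ball θ s, ‖t‖ ≤ ‖θ‖ + s := fun t ht => by
    have h1 : ‖t - θ‖ < s := by simpa [dist_eq_norm] using ht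
    have h2 := norm_add_le θ (t - θ)
    rw [add_sub_cancel] at h2
    linarith
  refine hasFDerivAt_integral_of_dominated_of_fderiv_le (bound := fun _ => K)
    (Metric.ball_mem_nhds θ hs) ?_ ?_ hm ?_ (integrable_const _) ?_
  · filter_upwards [hΘ.mem_nhds hθ] with t ht using hmeas t ht
  · refine Integrable.of_bound (C := K) (hmeas θ hθ) ?_
    filter_upwards [hP] with x hx
    exact (hK θ hθ (by linarith) x hx).1
  · filter_upwards [hP] with x hx t ht
    exact (hK t (hsub ht) (hnorm t ht) x hx).2
  · filter_upwards [hP] with x hx t ht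
    exact hdiff t (hsub ht) x hx

namespace Model

variable {d p : ℕ} (M : Model d p)

/-- The gradient of the loss in the parameter. -/
def gradLoss (θ : Euc d) (y : Fin 2) (x : Euc p) : Euc d := gradient (fun t => M.ℓ t x y) θ

/-- The Hessian of the loss in the parameter. -/
def hessLoss (θ : Euc d) (y : Fin 2) (x : Euc p) : Euc d →L[ℝ] Euc d :=
  hess (fun t => M.ℓ t x y) θ

variable {M} {𝒳 : Set (Euc p)}

theorem Setting.hasGradientAt_loss (hset : M.Setting 𝒳) {θ : Euc d} (hθ : θ ∈ M.Θ) {x : Euc p}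
    (hx : x ∈ 𝒳) (y : Fin 2) : HasGradientAt (fun t => M.ℓ t x y) (M.gradLoss θ y x) θ :=
  (((hset.contDiff_loss x hx y).contDiffAt (hset.isOpen.mem_nhds hθ)).differentiableAt
    (by norm_num)).hasGradientAt

theorem Setting.hasFDerivAt_gradLoss (hset : M.Setting 𝒳) {θ : Euc d} (hθ : θ ∈ M.Θ) {x : Euc p}
    (hx : x ∈ 𝒳) (y : Fin 2) : HasFDerivAt (fun t => M.gradLoss t y x) (M.hessLoss θ y x) θ := by
  have h1 := ((hset.contDiff_loss x hx y).contDiffAt (hset.isOpen.mem_nhds hθ)).fderiv_right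
    (m := 1) (by norm_num)
  have h2 : DifferentiableAt ℝ (gradient (fun t => M.ℓ t x y)) θ :=
    (InnerProductSpace.toDual ℝ (Euc d)).symm.differentiableAt.comp θ
      (h1.differentiableAt (by norm_num))
  exact h2.hasFDerivAt

/-- The gradient and the Hessian of the class risk are the means of those of the loss. -/
theorem Setting.classRisk_calculus (hset : M.Setting 𝒳) (P : Measure (Euc p))
    [IsProbabilityMeasure P] (hP : ∀ᵐ x ∂P, x ∈ 𝒳) (y : Fin 2) {θ : Euc d} (hθ : θ ∈ M.Θ) :
    AEStronglyMeasurable (M.gradLoss θ y) P ∧ AEStronglyMeasurable (M.hessLoss θ y) P ∧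
      HasGradientAt (M.classRisk P y) (∫ x, M.gradLoss θ y x ∂P) θ ∧
      HasFDerivAt (gradient (M.classRisk P y)) (∫ x, M.hessLoss θ y x ∂P) θ := by
  have hfirst : ∀ θ ∈ M.Θ, AEStronglyMeasurable (M.gradLoss θ y) P ∧
      HasGradientAt (M.classRisk P y) (∫ x, M.gradLoss θ y x ∂P) θ := by
    intro θ hθ
    obtain ⟨h1, h2⟩ := aestronglyMeasurable_and_hasFDerivAt_integral hset.isOpen hP
      (G := fun t x => M.ℓ t x y)
      (G' := fun t x => InnerProductSpace.toDual ℝ (Euc d) (M.gradLoss t y x))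
      (fun t ht => (hset.measurable_loss t ht y).aestronglyMeasurable)
      (fun t ht x hx => (hset.hasGradientAt_loss ht hx y).hasFDerivAt)
      (fun r => by
        obtain ⟨K, hK⟩ := hset.bound_loss r
        refine ⟨K, fun t ht htr x hx => ⟨(hK t ht htr x hx y).1, ?_⟩⟩
        rw [LinearIsometryEquiv.norm_map]
        exact (hK t ht htr x hx y).2.1) hθ
    have h3 : AEStronglyMeasurable (M.gradLoss θ y) P := by
      have := (InnerProductSpace.toDual ℝ (Euc d)).symm.continuous.comp_aestronglyMeasurable h1
      simpa using this
    refine ⟨h3, ?_⟩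
    rw [hasGradientAt_iff_hasFDerivAt]
    convert! h2 using 1
    exact ((InnerProductSpace.toDual ℝ (Euc d)).toContinuousLinearEquiv.integral_comp_comm _).symm
  -- The second differentiation takes as input the measurability of `gradLoss` that the first one
  -- produced.
  obtain ⟨h1, h2⟩ := aestronglyMeasurable_and_hasFDerivAt_integral hset.isOpen hP
    (G := fun t x => M.gradLoss t y x) (G' := fun t x => M.hessLoss t y x)
    (fun t ht => (hfirst t ht).1) (fun t ht x hx => hset.hasFDerivAt_gradLoss ht hx y)
    (fun r => by
      obtain ⟨K, hK⟩ := hset.bound_loss r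
      exact ⟨K, fun t ht htr x hx => (hK t ht htr x hx y).2⟩) hθ
  refine ⟨(hfirst θ hθ).1, h1, (hfirst θ hθ).2, h2.congr_of_eventuallyEq ?_⟩
  filter_upwards [hset.isOpen.mem_nhds hθ] with t ht
  exact (hfirst t ht).2.gradient

/-! ### Population and empirical means of labelled observables. -/

section Mixtures

variable (M) {E F : Type*} [NormedAddCommGroup E] [NormedSpace ℝ E] [NormedAddCommGroup F]
  [NormedSpace ℝ F]

/-- The population mean of a labelled observable with `m` synthetic samples. -/
def popMean (k m : ℕ) (f : Fin 2 → Euc p → E) : E :=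
  M.π₀ k m • ∫ x, f 0 x ∂M.P₀ + M.π₁ k m • ∫ x, f 1 x ∂M.P₁
    + M.πsyn k m • ∫ x, f 1 x ∂M.Psyn k

variable {M} {Ω : Type*} [MeasurableSpace Ω] {μ : Measure Ω}

/-- The mean of a labelled observable over the augmented sample with `m` synthetic samples. -/
def Samples.empMean (S : M.Samples μ) (k m : ℕ) (ω : Ω) (f : Fin 2 → Euc p → E) : E :=
  (1 / M.total k m) •
    (∑ i ∈ Finset.range (M.n₀ k), f 0 (S.X₀ k i ω)
      + ∑ i ∈ Finset.range (M.n₁ k), f 1 (S.X₁ k i ω)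
      + ∑ i ∈ Finset.range m, f 1 (S.Xsyn k i ω))

theorem Setting.n₀_pos (hset : M.Setting 𝒳) (k : ℕ) : 0 < M.n₀ k :=
  (Nat.zero_le _).trans_lt (hset.imbalanced k)

theorem n₀_le_total (k m : ℕ) : (M.n₀ k : ℝ) ≤ M.total k m := by
  have h1 : (0 : ℝ) ≤ M.n₁ k := Nat.cast_nonneg _
  have h2 : (0 : ℝ) ≤ m := Nat.cast_nonneg _
  unfold total
  linarith

theorem Setting.total_pos (hset : M.Setting 𝒳) (k m : ℕ) : 0 < M.total k m :=
  lt_of_lt_of_le (by exact_mod_cast hset.n₀_pos k) (n₀_le_total k m)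

theorem Setting.π_sum (hset : M.Setting 𝒳) (k m : ℕ) :
    M.π₀ k m + M.π₁ k m + M.πsyn k m = 1 := by
  have := hset.total_pos k m
  unfold π₀ π₁ πsyn
  rw [← add_div, ← add_div]
  exact div_self this.ne'

theorem Setting.π_nonneg (hset : M.Setting 𝒳) (k m : ℕ) :
    0 ≤ M.π₀ k m ∧ 0 ≤ M.π₁ k m ∧ 0 ≤ M.πsyn k m := by
  have := (hset.total_pos k m).le
  unfold π₀ π₁ πsyn
  exact ⟨by positivity, by positivity, by positivity⟩

/-- All observations of the experiments lie in `𝒳`. -/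
def Samples.InSupport (S : M.Samples μ) (𝒳 : Set (Euc p)) (ω : Ω) : Prop :=
  ∀ k i, S.X₀ k i ω ∈ 𝒳 ∧ S.X₁ k i ω ∈ 𝒳 ∧ S.Xsyn k i ω ∈ 𝒳

theorem Samples.ae_inSupport (S : M.Samples μ) (hset : M.Setting 𝒳) :
    ∀ᵐ ω ∂μ, S.InSupport 𝒳 ω := by
  unfold InSupport
  rw [ae_all_iff]; intro k
  rw [ae_all_iff]; intro i
  have h0 := hset.support₀
  have h1 := hset.support₁
  have h2 := hset.supportSyn k
  rw [← S.law₀ k i] at h0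
  rw [← S.law₁ k i] at h1
  rw [← S.lawSyn k i] at h2
  filter_upwards [ae_of_ae_map (S.measurable₀ k i).aemeasurable h0,
    ae_of_ae_map (S.measurable₁ k i).aemeasurable h1,
    ae_of_ae_map (S.measurableSyn k i).aemeasurable h2] with ω a b c using ⟨a, b, c⟩

theorem Setting.integral_norm_le {P : Measure (Euc p)} [IsProbabilityMeasure P]
    (hP : ∀ᵐ x ∂P, x ∈ 𝒳) {f : Euc p → E} {K : ℝ} (hf : ∀ x ∈ 𝒳, ‖f x‖ ≤ K) :
    ‖∫ x, f x ∂P‖ ≤ K := by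
  have := norm_integral_le_of_norm_le_const (μ := P) (f := f) (C := K)
    (by filter_upwards [hP] with x hx using hf x hx)
  simpa using this

theorem Setting.norm_popMean_le (hset : M.Setting 𝒳) (k m : ℕ) {f : Fin 2 → Euc p → E} {K : ℝ}
    (hf : ∀ x ∈ 𝒳, ∀ y, ‖f y x‖ ≤ K) : ‖M.popMean k m f‖ ≤ K := by
  have := hset.prob₀
  have := hset.prob₁
  have := hset.probSyn k
  obtain ⟨p0, p1, p2⟩ := hset.π_nonneg k m
  have h0 := integral_norm_le hset.support₀ (f := f 0) (fun x hx => hf x hx 0)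
  have h1 := integral_norm_le hset.support₁ (f := f 1) (fun x hx => hf x hx 1)
  have h2 := integral_norm_le (hset.supportSyn k) (f := f 1) (fun x hx => hf x hx 1)
  unfold popMean
  refine (norm_add₃_le).trans ?_
  rw [norm_smul, norm_smul, norm_smul, Real.norm_of_nonneg p0, Real.norm_of_nonneg p1,
    Real.norm_of_nonneg p2]
  calc _ ≤ M.π₀ k m * K + M.π₁ k m * K + M.πsyn k m * K := by gcongr
    _ = K := by rw [← add_mul, ← add_mul, hset.π_sum, one_mul]

theorem Samples.norm_empMean_le (S : M.Samples μ) (hset : M.Setting 𝒳) {ω : Ω}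
    (hω : S.InSupport 𝒳 ω) (k m : ℕ) {f : Fin 2 → Euc p → E} {K : ℝ}
    (hf : ∀ x ∈ 𝒳, ∀ y, ‖f y x‖ ≤ K) : ‖S.empMean k m ω f‖ ≤ K := by
  have hN := hset.total_pos k m
  unfold empMean
  rw [norm_smul, Real.norm_of_nonneg (by positivity), one_div, inv_mul_le_iff₀ hN]
  refine (norm_add₃_le).trans ?_
  have h0 : ‖∑ i ∈ Finset.range (M.n₀ k), f 0 (S.X₀ k i ω)‖ ≤ M.n₀ k * K := by
    simpa using norm_sum_le_of_le (Finset.range (M.n₀ k)) (fun i _ => hf _ (hω k i).1 0)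
  have h1 : ‖∑ i ∈ Finset.range (M.n₁ k), f 1 (S.X₁ k i ω)‖ ≤ M.n₁ k * K := by
    simpa using norm_sum_le_of_le (Finset.range (M.n₁ k)) (fun i _ => hf _ (hω k i).2.1 1)
  have h2 : ‖∑ i ∈ Finset.range m, f 1 (S.Xsyn k i ω)‖ ≤ m * K := by
    simpa using norm_sum_le_of_le (Finset.range m) (fun i _ => hf _ (hω k i).2.2 1)
  unfold total
  linarith

theorem Samples.empMean_sub (S : M.Samples μ) (k m : ℕ) (ω : Ω) (f g : Fin 2 → Euc p → E) :
    S.empMean k m ω (fun y x => f y x - g y x) = S.empMean k m ω f - S.empMean k m ω g := by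
  unfold empMean
  rw [← smul_sub]
  congr 1
  simp only [Finset.sum_sub_distrib]
  abel

theorem Samples.empMean_clm (S : M.Samples μ) (k m : ℕ) (ω : Ω) (L : E →L[ℝ] F)
    (f : Fin 2 → Euc p → E) :
    S.empMean k m ω (fun y x => L (f y x)) = L (S.empMean k m ω f) := by
  unfold empMean
  simp only [map_smul, map_add, map_sum]

/-- An observable that is a.e. measurable and bounded on `𝒳`, under all laws of the model. -/
structure Observable (M : Model d p) (𝒳 : Set (Euc p)) (f : Fin 2 → Euc p → E) (K : ℝ) :
    Prop where
  bound : ∀ x ∈ 𝒳, ∀ y, ‖f y x‖ ≤ K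
  meas₀ : AEStronglyMeasurable (f 0) M.P₀
  meas₁ : AEStronglyMeasurable (f 1) M.P₁
  measSyn : ∀ k, AEStronglyMeasurable (f 1) (M.Psyn k)

theorem Observable.integrable {G : Type*} [NormedAddCommGroup G] (hset : M.Setting 𝒳)
    {f : Fin 2 → Euc p → G} {K : ℝ}
    (hf : M.Observable 𝒳 f K) (k : ℕ) : Integrable (f 0) M.P₀ ∧ Integrable (f 1) M.P₁ ∧
      Integrable (f 1) (M.Psyn k) := by
  have := hset.prob₀
  have := hset.prob₁
  have := hset.probSyn k
  refine ⟨Integrable.of_bound (C := K) hf.meas₀ ?_, Integrable.of_bound (C := K) hf.meas₁ ?_,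
    Integrable.of_bound (C := K) (hf.measSyn k) ?_⟩
  · filter_upwards [hset.support₀] with x hx using hf.bound x hx 0
  · filter_upwards [hset.support₁] with x hx using hf.bound x hx 1
  · filter_upwards [hset.supportSyn k] with x hx using hf.bound x hx 1

theorem Observable.clm {f : Fin 2 → Euc p → E} {K : ℝ} (hf : M.Observable 𝒳 f K)
    (L : E →L[ℝ] F) : M.Observable 𝒳 (fun y x => L (f y x)) (‖L‖ * K) where
  bound x hx y := (L.le_opNorm _).trans (by gcongr; exact hf.bound x hx y)
  meas₀ := L.continuous.comp_aestronglyMeasurable hf.meas₀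
  meas₁ := L.continuous.comp_aestronglyMeasurable hf.meas₁
  measSyn k := L.continuous.comp_aestronglyMeasurable (hf.measSyn k)

theorem Observable.popMean_clm [CompleteSpace E] [CompleteSpace F] (hset : M.Setting 𝒳)
    {f : Fin 2 → Euc p → E} {K : ℝ}
    (hf : M.Observable 𝒳 f K) (L : E →L[ℝ] F) (k m : ℕ) :
    M.popMean k m (fun y x => L (f y x)) = L (M.popMean k m f) := by
  obtain ⟨h0, h1, h2⟩ := hf.integrable hset k
  unfold popMean
  rw [L.integral_comp_comm h0, L.integral_comp_comm h1, L.integral_comp_comm h2]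
  simp only [map_smul, map_add]

theorem Setting.loss_observable (hset : M.Setting 𝒳) {θ : Euc d} (hθ : θ ∈ M.Θ) :
    ∃ K, M.Observable 𝒳 (fun y x => M.ℓ θ x y) K := by
  obtain ⟨K, hK⟩ := hset.bound_loss ‖θ‖
  exact ⟨K, fun x hx y => (hK θ hθ le_rfl x hx y).1,
    (hset.measurable_loss θ hθ 0).aestronglyMeasurable,
    (hset.measurable_loss θ hθ 1).aestronglyMeasurable,
    fun k => (hset.measurable_loss θ hθ 1).aestronglyMeasurable⟩

theorem Setting.gradLoss_observable (hset : M.Setting 𝒳) {θ : Euc d} (hθ : θ ∈ M.Θ) :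
    ∃ K, M.Observable 𝒳 (M.gradLoss θ) K := by
  have := hset.prob₀
  have := hset.prob₁
  have := hset.probSyn
  obtain ⟨K, hK⟩ := hset.bound_loss ‖θ‖
  exact ⟨K, fun x hx y => (hK θ hθ le_rfl x hx y).2.1,
    (hset.classRisk_calculus _ hset.support₀ 0 hθ).1,
    (hset.classRisk_calculus _ hset.support₁ 1 hθ).1,
    fun k => (hset.classRisk_calculus _ (hset.supportSyn k) 1 hθ).1⟩

theorem Setting.hessLoss_observable (hset : M.Setting 𝒳) {θ : Euc d} (hθ : θ ∈ M.Θ) :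
    ∃ K, M.Observable 𝒳 (M.hessLoss θ) K := by
  have := hset.prob₀
  have := hset.prob₁
  have := hset.probSyn
  obtain ⟨K, hK⟩ := hset.bound_loss ‖θ‖
  exact ⟨K, fun x hx y => (hK θ hθ le_rfl x hx y).2.2,
    (hset.classRisk_calculus _ hset.support₀ 0 hθ).2.1,
    (hset.classRisk_calculus _ hset.support₁ 1 hθ).2.1,
    fun k => (hset.classRisk_calculus _ (hset.supportSyn k) 1 hθ).2.1⟩

theorem hasGradientAt_combination {f g h : Euc d → ℝ} {a b c θ : Euc d} (hf : HasGradientAt f a θ)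
    (hg : HasGradientAt g b θ) (hh : HasGradientAt h c θ) (r s t : ℝ) :
    HasGradientAt (fun θ => r * f θ + s * g θ + t * h θ) (r • a + s • b + t • c) θ := by
  rw [hasGradientAt_iff_hasFDerivAt] at *
  convert! ((hf.const_mul r).add (hg.const_mul s)).add (hh.const_mul t) using 1
  simp

theorem Setting.hasGradientAt_synRisk (hset : M.Setting 𝒳) (k m : ℕ) {θ : Euc d}
    (hθ : θ ∈ M.Θ) : HasGradientAt (M.synRisk k m) (M.popMean k m (M.gradLoss θ)) θ := by
  have := hset.prob₀
  have := hset.prob₁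
  have := hset.probSyn k
  exact hasGradientAt_combination (hset.classRisk_calculus _ hset.support₀ 0 hθ).2.2.1
    (hset.classRisk_calculus _ hset.support₁ 1 hθ).2.2.1
    (hset.classRisk_calculus _ (hset.supportSyn k) 1 hθ).2.2.1 _ _ _

theorem Setting.hasFDerivAt_popMean_gradLoss (hset : M.Setting 𝒳) (k m : ℕ) {θ : Euc d}
    (hθ : θ ∈ M.Θ) : HasFDerivAt (fun t => M.popMean k m (M.gradLoss t))
      (M.popMean k m (M.hessLoss θ)) θ := by
  have := hset.prob₀
  have := hset.prob₁
  have := hset.probSyn k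
  have h := (((hset.classRisk_calculus _ hset.support₀ 0 hθ).2.2.2.const_smul (M.π₀ k m)).add
    ((hset.classRisk_calculus _ hset.support₁ 1 hθ).2.2.2.const_smul (M.π₁ k m))).add
    ((hset.classRisk_calculus _ (hset.supportSyn k) 1 hθ).2.2.2.const_smul (M.πsyn k m))
  refine h.congr_of_eventuallyEq ?_
  filter_upwards [hset.isOpen.mem_nhds hθ] with t ht
  simp only [popMean, Pi.add_apply, Pi.smul_apply]
  rw [(hset.classRisk_calculus _ hset.support₀ 0 ht).2.2.1.gradient,
    (hset.classRisk_calculus _ hset.support₁ 1 ht).2.2.1.gradient,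
    (hset.classRisk_calculus _ (hset.supportSyn k) 1 ht).2.2.1.gradient]

theorem Setting.hess_synRisk (hset : M.Setting 𝒳) (k m : ℕ) {θ : Euc d}
    (hθ : θ ∈ M.Θ) : hess (M.synRisk k m) θ = M.popMean k m (M.hessLoss θ) := by
  refine HasFDerivAt.fderiv ((hset.hasFDerivAt_popMean_gradLoss k m hθ).congr_of_eventuallyEq ?_)
  filter_upwards [hset.isOpen.mem_nhds hθ] with t ht
  exact (hset.hasGradientAt_synRisk k m ht).gradient

theorem Samples.hasGradientAt_empRisk (S : M.Samples μ) (hset : M.Setting 𝒳) {ω : Ω}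
    (hω : S.InSupport 𝒳 ω) (k m : ℕ) {θ : Euc d} (hθ : θ ∈ M.Θ) :
    HasGradientAt (S.empRisk k m ω) (S.empMean k m ω (M.gradLoss θ)) θ := by
  rw [hasGradientAt_iff_hasFDerivAt]
  have h := ((HasFDerivAt.fun_sum (u := Finset.range (M.n₀ k)) fun i _ =>
      (hset.hasGradientAt_loss hθ (hω k i).1 0).hasFDerivAt).add
    (HasFDerivAt.fun_sum (u := Finset.range (M.n₁ k)) fun i _ =>
      (hset.hasGradientAt_loss hθ (hω k i).2.1 1).hasFDerivAt)).add
    (HasFDerivAt.fun_sum (u := Finset.range m) fun i _ =>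
      (hset.hasGradientAt_loss hθ (hω k i).2.2 1).hasFDerivAt)
  convert! h.const_mul (1 / M.total k m) using 1
  simp [empMean, map_sum]

theorem Samples.hasFDerivAt_empMean_gradLoss (S : M.Samples μ) (hset : M.Setting 𝒳) {ω : Ω}
    (hω : S.InSupport 𝒳 ω) (k m : ℕ) {θ : Euc d} (hθ : θ ∈ M.Θ) :
    HasFDerivAt (fun t => S.empMean k m ω (M.gradLoss t)) (S.empMean k m ω (M.hessLoss θ)) θ := by
  have h := ((HasFDerivAt.fun_sum (u := Finset.range (M.n₀ k)) fun i _ =>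
      (hset.hasFDerivAt_gradLoss hθ (hω k i).1 0)).add
    (HasFDerivAt.fun_sum (u := Finset.range (M.n₁ k)) fun i _ =>
      (hset.hasFDerivAt_gradLoss hθ (hω k i).2.1 1))).add
    (HasFDerivAt.fun_sum (u := Finset.range m) fun i _ =>
      (hset.hasFDerivAt_gradLoss hθ (hω k i).2.2 1))
  exact h.const_smul (1 / M.total k m)

end Mixtures

end Model

/-! ### Events of probability tending to one. -/

section HighProbability

variable {Ω : Type*} [MeasurableSpace Ω] {μ : Measure Ω}

theorem WithHighProb.mono {A B : ℕ → Set Ω} (hA : WithHighProb μ A) (h : ∀ᶠ k in atTop, A k ⊆ B k) :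
    WithHighProb μ B := by
  refine tendsto_of_tendsto_of_tendsto_of_le_of_le' tendsto_const_nhds hA
    (Eventually.of_forall fun _ => zero_le) ?_
  filter_upwards [h] with k hk
  exact measure_mono (Set.compl_subset_compl.2 hk)

theorem WithHighProb.inter {A B : ℕ → Set Ω} (hA : WithHighProb μ A) (hB : WithHighProb μ B) :
    WithHighProb μ (fun k => A k ∩ B k) := by
  have h : Tendsto (fun k => μ (A k)ᶜ + μ (B k)ᶜ) atTop (𝓝 0) := by simpa using hA.add hB
  refine tendsto_of_tendsto_of_tendsto_of_le_of_le tendsto_const_nhds h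
    (fun _ => zero_le) fun k => ?_
  simp only [Set.compl_inter]
  exact measure_union_le _ _

theorem WithHighProb.of_ae {P : Ω → Prop} (h : ∀ᵐ ω ∂μ, P ω) :
    WithHighProb μ (fun _ => {ω | P ω}) := by
  have : μ {ω | P ω}ᶜ = 0 := h
  simp [WithHighProb, this]

theorem WithHighProb.of_eventually {P : ℕ → Prop} (h : ∀ᶠ k in atTop, P k) :
    WithHighProb μ (fun k => {_ω : Ω | P k}) := by
  refine tendsto_const_nhds.congr' ?_
  filter_upwards [h] with k hk
  simp [hk]

theorem WithHighProb.forall_finset {ι : Type*} (s : Finset ι) {A : ι → ℕ → Set Ω}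
    (h : ∀ i ∈ s, WithHighProb μ (A i)) : WithHighProb μ (fun k => {ω | ∀ i ∈ s, ω ∈ A i k}) := by
  classical
  induction s using Finset.induction_on with
  | empty => simp [WithHighProb]
  | insert a s ha ih =>
    refine ((h a (by simp)).inter (ih fun i hi => h i (by simp [hi]))).mono
      (Eventually.of_forall fun k ω hω i hi => ?_)
    rcases Finset.mem_insert.1 hi with rfl | hi
    · exact hω.1
    · exact hω.2 i hi

theorem WithHighProb.eventually_le {A : ℕ → Set Ω} (h : WithHighProb μ A) {ε : ℝ} (hε : 0 < ε) :
    ∀ᶠ k in atTop, μ (A k)ᶜ ≤ ENNReal.ofReal ε := by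
  filter_upwards [h.eventually (gt_mem_nhds (ENNReal.ofReal_pos.2 hε))] with k hk using hk.le

/-- This extracts deterministic facts, such as nondegeneracy of the fixed law `P₀` at `θs`, from
conditions that hold only with high probability. -/
theorem WithHighProb.exists_mem [IsProbabilityMeasure μ] {A : ℕ → Set Ω} (h : WithHighProb μ A) :
    ∃ k ω, ω ∈ A k := by
  obtain ⟨k, hk⟩ := (h.eventually (gt_mem_nhds (zero_lt_one (α := ENNReal)))).exists
  by_contra! hne
  have : (A k)ᶜ = Set.univ := Set.eq_univ_of_forall fun ω => hne k ω
  rw [this, measure_univ] at hk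
  exact lt_irrefl _ hk

end HighProbability

/-! ### Chebyshev bounds and anti-concentration for the augmented sample. -/

namespace Model

variable {d p : ℕ} {M : Model d p} {𝒳 : Set (Euc p)} {Ω : Type*} [MeasurableSpace Ω]
  {μ : Measure Ω}

/-- The pooled family of observations of experiment `k`. -/
def Samples.obs (S : M.Samples μ) (k : ℕ) : ℕ ⊕ ℕ ⊕ ℕ → Ω → Euc p :=
  Sum.elim (S.X₀ k) (Sum.elim (S.X₁ k) (S.Xsyn k))

/-- The label of an observation. -/
def label : ℕ ⊕ ℕ ⊕ ℕ → Fin 2 := Sum.elim (fun _ => 0) (fun _ => 1)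

variable (M) in
/-- The law of an observation. -/
def obsLaw (k : ℕ) : ℕ ⊕ ℕ ⊕ ℕ → Measure (Euc p) :=
  Sum.elim (fun _ => M.P₀) (Sum.elim (fun _ => M.P₁) (fun _ => M.Psyn k))

variable (M) in
/-- The observations used with `m` synthetic samples. -/
def obsIndex (k m : ℕ) : Finset (ℕ ⊕ ℕ ⊕ ℕ) :=
  (Finset.range (M.n₀ k)).disjSum ((Finset.range (M.n₁ k)).disjSum (Finset.range m))

theorem Samples.measurable_obs (S : M.Samples μ) (k : ℕ) (s : ℕ ⊕ ℕ ⊕ ℕ) :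
    Measurable (S.obs k s) := by
  rcases s with i | i | i
  exacts [S.measurable₀ k i, S.measurable₁ k i, S.measurableSyn k i]

theorem Samples.map_obs (S : M.Samples μ) (k : ℕ) (s : ℕ ⊕ ℕ ⊕ ℕ) :
    μ.map (S.obs k s) = M.obsLaw k s := by
  rcases s with i | i | i
  exacts [S.law₀ k i, S.law₁ k i, S.lawSyn k i]

theorem card_obsIndex (k m : ℕ) : ((M.obsIndex k m).card : ℝ) = M.total k m := by
  simp [obsIndex, total, Finset.card_disjSum, add_assoc]

theorem Samples.empMean_eq_sum {E : Type*} [NormedAddCommGroup E] [NormedSpace ℝ E]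
    (S : M.Samples μ) (k m : ℕ) (ω : Ω) (f : Fin 2 → Euc p → E) :
    S.empMean k m ω f =
      (1 / M.total k m) • ∑ s ∈ M.obsIndex k m, f (label s) (S.obs k s ω) := by
  simp [empMean, obsIndex, Finset.sum_disjSum, label, obs, add_assoc]

/-- A Borel version of an observable, along the observations. -/
theorem Samples.exists_version (S : M.Samples μ) (hset : M.Setting 𝒳) {f : Fin 2 → Euc p → ℝ}
    {K : ℝ} (hf : M.Observable 𝒳 f K) (k : ℕ) : ∃ g : ℕ ⊕ ℕ ⊕ ℕ → Euc p → ℝ,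
      (∀ s, Measurable (g s)) ∧ (∀ s, g s =ᵐ[M.obsLaw k s] f (label s)) ∧
      (∀ᵐ ω ∂μ, ∀ s, g s (S.obs k s ω) = f (label s) (S.obs k s ω)) ∧
      ∀ s, ∀ᵐ ω ∂μ, ‖g s (S.obs k s ω)‖ ≤ K := by
  -- Independence is applied to Borel functions and events, whereas observables are only a.e.
  -- measurable.
  have hm : ∀ s, AEStronglyMeasurable (f (label s)) (M.obsLaw k s) := by
    rintro (i | i | i)
    exacts [hf.meas₀, hf.meas₁, hf.measSyn k]
  have hae : ∀ᵐ ω ∂μ, ∀ s, (hm s).mk _ (S.obs k s ω) = f (label s) (S.obs k s ω) := by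
    rw [ae_all_iff]
    intro s
    have := (hm s).ae_eq_mk
    -- The representative depends on the measure, so it is abstracted before the law is rewritten as
    -- a push-forward.
    generalize (hm s).mk _ = g at this
    rw [← S.map_obs] at this
    filter_upwards [ae_of_ae_map (S.measurable_obs k s).aemeasurable this] with ω hω using hω.symm
  refine ⟨fun s => (hm s).mk _, fun s => (hm s).stronglyMeasurable_mk.measurable,
    fun s => (hm s).ae_eq_mk.symm, hae, fun s => ?_⟩
  filter_upwards [hae, S.ae_inSupport hset] with ω h1 h2
  rw [h1 s]
  rcases s with i | i | i
  exacts [hf.bound _ (h2 k i).1 _, hf.bound _ (h2 k i).2.1 _, hf.bound _ (h2 k i).2.2 _]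

theorem Samples.integral_obs (S : M.Samples μ) {k : ℕ} {s : ℕ ⊕ ℕ ⊕ ℕ} {g f : Euc p → ℝ}
    (hg : Measurable g) (hgf : g =ᵐ[M.obsLaw k s] f) :
    ∫ ω, g (S.obs k s ω) ∂μ = ∫ x, f x ∂(M.obsLaw k s) := by
  rw [← integral_congr_ae hgf, ← S.map_obs k s,
    integral_map (S.measurable_obs k s).aemeasurable hg.aestronglyMeasurable]

theorem Setting.sum_integral (hset : M.Setting 𝒳) (k m : ℕ) (f : Fin 2 → Euc p → ℝ) :
    ∑ s ∈ M.obsIndex k m, ∫ x, f (label s) x ∂(M.obsLaw k s) =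
      M.total k m * M.popMean k m f := by
  have := (hset.total_pos k m).ne'
  simp only [obsIndex, Finset.sum_disjSum, label, obsLaw, Sum.elim_inl, Sum.elim_inr,
    Finset.sum_const, Finset.card_range, popMean, π₀, π₁, πsyn, smul_eq_mul, nsmul_eq_mul]
  field_simp
  ring

theorem Samples.iIndepFun_version [IsProbabilityMeasure μ] (S : M.Samples μ) (k : ℕ)
    {g : ℕ ⊕ ℕ ⊕ ℕ → Euc p → ℝ} (hg : ∀ s, Measurable (g s)) :
    iIndepFun (fun s ω => g s (S.obs k s ω)) μ :=
  (S.indep k).comp g hg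

/-- Chebyshev's inequality for the empirical mean of a real observable, at an independent random
synthetic size. -/
theorem Samples.measure_deviation_real_le [IsProbabilityMeasure μ] (S : M.Samples μ)
    (hset : M.Setting 𝒳) {f : Fin 2 → Euc p → ℝ} {K : ℝ} (hf : M.Observable 𝒳 f K)
    {nt : ℕ → Ω → ℕ} (hnt : S.IndependentSize nt) (k : ℕ) {t : ℝ} (ht : 0 < t) :
    μ {ω | t < |S.empMean k (nt k ω) ω f - M.popMean k (nt k ω) f|} ≤
      ENNReal.ofReal (K ^ 2 / (M.n₀ k * t ^ 2)) := by
  obtain ⟨g, hgm, hgf, hgae, hgb⟩ := S.exists_version hset hf k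
  -- The bad event is stated on sample paths for each fixed `m`, as `measure_random_index_le`
  -- requires.
  let B : ℕ → Set (ℕ ⊕ ℕ ⊕ ℕ → Euc p) := fun m =>
    {y | t < |1 / M.total k m * ∑ s ∈ M.obsIndex k m, g s (y s) - M.popMean k m f|}
  have hB : ∀ m, MeasurableSet (B m) := fun m => by
    refine measurableSet_lt measurable_const ?_
    have : Measurable fun y : ℕ ⊕ ℕ ⊕ ℕ → Euc p => ∑ s ∈ M.obsIndex k m, g s (y s) :=
      Finset.measurable_fun_sum _ fun s _ => (hgm s).comp (measurable_pi_apply s)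
    exact ((this.const_mul _).sub_const _).abs
  have hn0 : (0 : ℝ) < M.n₀ k := by exact_mod_cast hset.n₀_pos k
  have hle : ∀ m, μ ((fun ω s => S.obs k s ω) ⁻¹' B m) ≤
      ENNReal.ofReal (K ^ 2 / (M.n₀ k * t ^ 2)) := by
    intro m
    have hN := hset.total_pos k m
    have hL2 : ∀ s, MemLp (fun ω => g s (S.obs k s ω)) 2 μ := fun s =>
      MemLp.of_bound ((hgm s).comp (S.measurable_obs k s)).aestronglyMeasurable K (hgb s)
    have hvar : Var[∑ s ∈ M.obsIndex k m, fun ω => g s (S.obs k s ω); μ] ≤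
        M.total k m * K ^ 2 := by
      rw [IndepFun.variance_sum (fun s _ => hL2 s)
        (fun s _ s' _ hne => (S.iIndepFun_version k hgm).indepFun hne), ← card_obsIndex,
        ← nsmul_eq_mul]
      refine Finset.sum_le_card_nsmul _ _ _ fun s _ => ?_
      refine (variance_le_expectation_sq (hL2 s).1).trans ?_
      have hle : ∀ᵐ ω ∂μ, ((fun ω => g s (S.obs k s ω)) ^ 2) ω ≤ K ^ 2 := by
        filter_upwards [hgb s] with ω hω
        exact sq_le_sq' (by linarith [(abs_le.1 hω).1]) (abs_le.1 hω).2
      have := integral_mono_ae (hL2 s).integrable_sq (integrable_const (K ^ 2)) hle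
      simpa using this
    have hmean : ∫ ω, (∑ s ∈ M.obsIndex k m, fun ω => g s (S.obs k s ω)) ω ∂μ =
        M.total k m * M.popMean k m f := by
      simp only [Finset.sum_apply]
      rw [integral_finsetSum _ fun s _ => (hL2 s).integrable (by norm_num),
        ← hset.sum_integral]
      exact Finset.sum_congr rfl fun s _ => S.integral_obs (hgm s) (hgf s)
    have hcheb := meas_ge_le_variance_div_sq (memLp_finsetSum' (M.obsIndex k m) fun s _ => hL2 s)
      (c := M.total k m * t) (by positivity)
    rw [hmean] at hcheb
    refine (measure_mono fun ω hω => ?_).trans (hcheb.trans (ENNReal.ofReal_le_ofReal ?_))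
    · have hω' : t < |1 / M.total k m * ∑ s ∈ M.obsIndex k m, g s (S.obs k s ω)
        - M.popMean k m f| := hω
      have heq : (∑ s ∈ M.obsIndex k m, fun ω => g s (S.obs k s ω)) ω
          - M.total k m * M.popMean k m f = M.total k m *
          (1 / M.total k m * ∑ s ∈ M.obsIndex k m, g s (S.obs k s ω) - M.popMean k m f) := by
        rw [Finset.sum_apply]
        field_simp
      change M.total k m * t ≤ |_|
      rw [heq, abs_mul, abs_of_pos hN]
      gcongr
    · calc _ ≤ M.total k m * K ^ 2 / (M.total k m * t) ^ 2 := by gcongr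
        _ = K ^ 2 / (M.total k m * t ^ 2) := by field_simp
        -- Replacing the total size by `n₀` frees the bound from `m`.
        _ ≤ _ := by
          gcongr
          exact n₀_le_total k m
  refine le_trans (measure_mono_ae ?_)
    (measure_random_index_le (hnt k).1 (hnt k).2 hB (by exact hle))
  filter_upwards [hgae] with ω hω hlt
  change t < |1 / M.total k (nt k ω) * ∑ s ∈ M.obsIndex k (nt k ω), g s (S.obs k s ω)
    - M.popMean k (nt k ω) f|
  rw [Finset.sum_congr rfl fun s _ => hω s, ← smul_eq_mul, ← S.empMean_eq_sum]
  exact hlt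

/-- Chebyshev's inequality for the empirical mean of a finite-dimensional observable. -/
theorem Samples.exists_measure_deviation_le [IsProbabilityMeasure μ] {E : Type*}
    [NormedAddCommGroup E] [NormedSpace ℝ E] [FiniteDimensional ℝ E] (S : M.Samples μ)
    (hset : M.Setting 𝒳) {f : Fin 2 → Euc p → E} {K : ℝ} (hf : M.Observable 𝒳 f K) :
    ∃ C : ℝ, 0 < C ∧ ∀ nt : ℕ → Ω → ℕ, S.IndependentSize nt → ∀ k (t : ℝ), 0 < t →
      μ {ω | t < ‖S.empMean k (nt k ω) ω f - M.popMean k (nt k ω) f‖} ≤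
        ENNReal.ofReal (C / (M.n₀ k * t ^ 2)) := by
  obtain ⟨n, L, D, hD, hL⟩ := exists_functionals_norm_le E
  have := FiniteDimensional.complete ℝ E
  refine ⟨∑ i, ((‖L i‖ * K) ^ 2 * D ^ 2) + 1, by positivity, fun nt hnt k t ht => ?_⟩
  have hn0 : (0 : ℝ) < M.n₀ k := by exact_mod_cast hset.n₀_pos k
  calc μ {ω | t < ‖S.empMean k (nt k ω) ω f - M.popMean k (nt k ω) f‖}
      ≤ μ (⋃ i, {ω | t / D < |S.empMean k (nt k ω) ω (fun y x => L i (f y x))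
          - M.popMean k (nt k ω) (fun y x => L i (f y x))|}) := by
        refine measure_mono fun ω hω => ?_
        by_contra hne
        simp only [Set.mem_iUnion, Set.mem_ofPred_eq, not_exists, not_lt] at hne
        have hω' : t < ‖S.empMean k (nt k ω) ω f - M.popMean k (nt k ω) f‖ := hω
        have h := hL (S.empMean k (nt k ω) ω f - M.popMean k (nt k ω) f) (t / D) (fun i => by
          have := hne i
          rwa [S.empMean_clm, hf.popMean_clm hset, ← map_sub] at this) (by positivity)
        rw [mul_div_cancel₀ _ hD.ne'] at h
        linarith
    _ ≤ ∑ i, μ {ω | t / D < |S.empMean k (nt k ω) ω (fun y x => L i (f y x))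
          - M.popMean k (nt k ω) (fun y x => L i (f y x))|} := measure_iUnion_fintype_le _ _
    _ ≤ ∑ i, ENNReal.ofReal ((‖L i‖ * K) ^ 2 / (M.n₀ k * (t / D) ^ 2)) := by
        gcongr with i
        exact S.measure_deviation_real_le hset (hf.clm (L i)) hnt k (by positivity)
    _ = ENNReal.ofReal (∑ i, (‖L i‖ * K) ^ 2 / (M.n₀ k * (t / D) ^ 2)) := by
        rw [ENNReal.ofReal_sum_of_nonneg]
        intro i _
        positivity
    _ ≤ _ := by
        apply ENNReal.ofReal_le_ofReal
        have : ∀ i, (‖L i‖ * K) ^ 2 / (M.n₀ k * (t / D) ^ 2) =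
            (‖L i‖ * K) ^ 2 * D ^ 2 / (M.n₀ k * t ^ 2) := fun i => by
          field_simp
        rw [Finset.sum_congr rfl fun i _ => this i, ← Finset.sum_div]
        gcongr
        linarith

theorem Setting.n₀_tendsto (hset : M.Setting 𝒳) : Tendsto (fun k => (M.n₀ k : ℝ)) atTop atTop :=
  tendsto_natCast_atTop_atTop.comp
    (tendsto_atTop_mono (fun k => (hset.imbalanced k).le) hset.n₁_tendsto)

theorem Samples.deviation_whp [IsProbabilityMeasure μ] {E : Type*}
    [NormedAddCommGroup E] [NormedSpace ℝ E] [FiniteDimensional ℝ E] (S : M.Samples μ)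
    (hset : M.Setting 𝒳) {f : Fin 2 → Euc p → E} {K : ℝ} (hf : M.Observable 𝒳 f K)
    {nt : ℕ → Ω → ℕ} (hnt : S.IndependentSize nt) {t : ℝ} (ht : 0 < t) :
    WithHighProb μ
      (fun k => {ω | ‖S.empMean k (nt k ω) ω f - M.popMean k (nt k ω) f‖ ≤ t}) := by
  obtain ⟨C, -, hC⟩ := S.exists_measure_deviation_le hset hf
  have h : Tendsto (fun k => ENNReal.ofReal (C / (M.n₀ k * t ^ 2))) atTop (𝓝 0) := by
    rw [← ENNReal.ofReal_zero]
    refine ENNReal.tendsto_ofReal (Tendsto.const_div_atTop ?_ C)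
    exact hset.n₀_tendsto.atTop_mul_const (by positivity)
  refine tendsto_of_tendsto_of_tendsto_of_le_of_le tendsto_const_nhds h
    (fun _ => zero_le) fun k => ?_
  refine (measure_mono fun ω hω => ?_).trans (hC nt hnt k t ht)
  exact not_le.1 (Set.notMem_ofPred_iff.1 hω)

theorem Samples.deviation_isBigOP [IsProbabilityMeasure μ] {E : Type*}
    [NormedAddCommGroup E] [NormedSpace ℝ E] [FiniteDimensional ℝ E] (S : M.Samples μ)
    (hset : M.Setting 𝒳) {f : Fin 2 → Euc p → E} {K : ℝ} (hf : M.Observable 𝒳 f K)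
    {nt : ℕ → Ω → ℕ} (hnt : S.IndependentSize nt) :
    IsBigOP μ (fun k ω => ‖S.empMean k (nt k ω) ω f - M.popMean k (nt k ω) f‖)
      (fun k => 1 / √(M.n₀ k : ℝ)) := by
  obtain ⟨C, hCpos, hC⟩ := S.exists_measure_deviation_le hset hf
  intro ε hε
  refine ⟨√(C / ε), Real.sqrt_pos.2 (by positivity), Eventually.of_forall fun k => ?_⟩
  have hn0 : (0 : ℝ) < M.n₀ k := by exact_mod_cast hset.n₀_pos k
  simp only [abs_norm]
  refine (hC nt hnt k _ (by positivity)).trans (ENNReal.ofReal_le_ofReal (le_of_eq ?_))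
  rw [mul_pow, div_pow, Real.sq_sqrt (by positivity), Real.sq_sqrt hn0.le]
  field_simp

/-- Anti-concentration of the empirical mean of an observable that is not degenerate for the
majority class, uniformly over independent random synthetic sizes. -/
theorem Samples.exists_anticoncentration [IsProbabilityMeasure μ] (S : M.Samples μ)
    (hset : M.Setting 𝒳) {f : Fin 2 → Euc p → ℝ} {K : ℝ} (hf : M.Observable 𝒳 f K)
    (hv : Var[f 0; M.P₀] ≠ 0) {nt : ℕ → Ω → ℕ} (hnt : S.IndependentSize nt) {ε : ℝ}
    (hε : 0 < ε) : ∃ c : ℝ, 0 < c ∧ ∀ᶠ k in atTop,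
      μ {ω | M.total k (nt k ω) * |S.empMean k (nt k ω) ω f| ≤ c * √(M.n₀ k : ℝ)} ≤
        ENNReal.ofReal ε := by
  have := hset.prob₀
  have hf0 : AEMeasurable (f 0) M.P₀ := hf.meas₀.aemeasurable
  have hprob : IsProbabilityMeasure (M.P₀.map (f 0)) := Measure.isProbabilityMeasure_map hf0
  -- The reference law does not depend on `k`, so its threshold on `n` is eventually passed by `n₀
  -- k`.
  obtain ⟨c, hc, hev⟩ := exists_small_ball (M.P₀.map (f 0)) (by rwa [variance_id_map hf0]) hε
  have htend : Tendsto M.n₀ atTop atTop :=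
    tendsto_atTop_mono (fun k => (hset.imbalanced k).le) hset.n₁_tendsto
  refine ⟨c, hc, (htend.eventually hev).mono fun k hk => ?_⟩
  obtain ⟨g, hgm, hgf, hgae, -⟩ := S.exists_version hset hf k
  let B : ℕ → Set (ℕ ⊕ ℕ ⊕ ℕ → Euc p) := fun m =>
    {y | |∑ s ∈ M.obsIndex k m, g s (y s)| ≤ c * √(M.n₀ k : ℝ)}
  have hBm : ∀ m, Measurable fun y : ℕ ⊕ ℕ ⊕ ℕ → Euc p => ∑ s ∈ M.obsIndex k m, g s (y s) :=
    fun m => Finset.measurable_fun_sum _ fun s _ => (hgm s).comp (measurable_pi_apply s)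
  have hB : ∀ m, MeasurableSet (B m) := fun m => measurableSet_le (hBm m).abs measurable_const
  have hle : ∀ m, μ ((fun ω s => S.obs k s ω) ⁻¹' B m) ≤ ENNReal.ofReal ε := by
    intro m
    have hTm : ∀ s, Measurable (fun ω => g s (S.obs k s ω)) := fun s =>
      (hgm s).comp (S.measurable_obs k s)
    have hsum : Measurable (fun ω => ∑ s ∈ M.obsIndex k m, g s (S.obs k s ω)) :=
      Finset.measurable_fun_sum _ fun s _ => hTm s
    have hρ : IsProbabilityMeasure (μ.map (fun ω => ∑ s ∈ M.obsIndex k m, g s (S.obs k s ω))) :=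
      Measure.isProbabilityMeasure_map hsum.aemeasurable
    have hprob' : ∀ s, IsProbabilityMeasure (μ.map (fun ω => g s (S.obs k s ω))) := fun s =>
      Measure.isProbabilityMeasure_map (hTm s).aemeasurable
    have hlaw : ∀ i, μ.map (fun ω => g (Sum.inl i) (S.obs k (Sum.inl i) ω)) = M.P₀.map (f 0) := by
      intro i
      have h1 : M.P₀.map (g (Sum.inl i)) = M.P₀.map (f 0) := Measure.map_congr (hgf (Sum.inl i))
      have h2 : μ.map (S.obs k (Sum.inl i)) = M.P₀ := S.map_obs k (Sum.inl i)
      rw [← h1, ← h2, Measure.map_map (hgm _) (S.measurable_obs k _)]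
      rfl
    -- By independence the characteristic function factorizes. Minority and synthetic factors have
    -- modulus at most one and are dropped, so neither `m` nor `Psyn k` matters.
    have hchar : ∀ t, ‖charFun (μ.map (fun ω => ∑ s ∈ M.obsIndex k m, g s (S.obs k s ω))) t‖ ≤
        ‖charFun (M.P₀.map (f 0)) t‖ ^ (M.n₀ k) := by
      intro t
      rw [iIndepFun.charFun_map_fun_finsetSum_eq_prod (fun s _ => (hTm s).aemeasurable)
        ((S.iIndepFun_version k hgm).restrict _), Finset.prod_apply, norm_prod, obsIndex,
        Finset.prod_disjSum]
      simp only [hlaw, Finset.prod_const, Finset.card_range]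
      refine mul_le_of_le_one_right (by positivity) ?_
      exact Finset.prod_le_one (fun _ _ => norm_nonneg _) fun s _ => norm_charFun_le_one _
    have hb := hk _ hchar
    have hb' := (ENNReal.le_ofReal_iff_toReal_le (measure_ne_top _ _) hε.le).2 hb
    have hms : MeasurableSet {x : ℝ | |x| ≤ c * √(M.n₀ k : ℝ)} :=
      measurableSet_le measurable_id.abs measurable_const
    rw [Measure.map_apply hsum hms] at hb'
    exact hb'
  refine le_trans (measure_mono_ae ?_)
    (measure_random_index_le (hnt k).1 (hnt k).2 hB (by exact hle))
  filter_upwards [hgae] with ω hω hlt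
  have hN := hset.total_pos k (nt k ω)
  change |∑ s ∈ M.obsIndex k (nt k ω), g s (S.obs k s ω)| ≤ _
  rw [Finset.sum_congr rfl fun s _ => hω s]
  have hlt' : M.total k (nt k ω) * |S.empMean k (nt k ω) ω f| ≤ c * √(M.n₀ k : ℝ) := hlt
  rwa [S.empMean_eq_sum, smul_eq_mul, abs_mul, abs_of_pos (by positivity), ← mul_assoc,
    mul_one_div_cancel hN.ne', one_mul] at hlt'

end Model

/-! ### Localization of the minimizer and comparison of the excess risk with the gradient. -/

theorem abs_sub_le_of_hasGradientAt {d : ℕ} {s : Set (Euc d)} (hs : Convex ℝ s) {f : Euc d → ℝ}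
    {g : Euc d → Euc d} (hf : ∀ θ ∈ s, HasGradientAt f (g θ) θ) {K : ℝ} (hK : ∀ θ ∈ s, ‖g θ‖ ≤ K)
    {θ θ' : Euc d} (hθ : θ ∈ s) (hθ' : θ' ∈ s) : |f θ' - f θ| ≤ K * ‖θ' - θ‖ :=
  hs.norm_image_sub_le_of_norm_hasFDerivWithin_le
    (fun x hx => (hf x hx).hasFDerivAt.hasFDerivWithinAt)
    (fun x hx => by rw [LinearIsometryEquiv.norm_map]; exact hK x hx) hθ hθ'

theorem HasGradientAt.eq_zero_of_isMinOn {d : ℕ} {s : Set (Euc d)} {f : Euc d → ℝ} {g θ : Euc d}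
    (hf : HasGradientAt f g θ) (hs : s ∈ 𝓝 θ) (hmin : ∀ t ∈ s, f θ ≤ f t) : g = 0 := by
  have hloc : IsLocalMin f θ := by
    filter_upwards [hs] with t ht using hmin t ht
  have := hloc.hasFDerivAt_eq_zero hf.hasFDerivAt
  simpa using this

namespace Model

variable {d p : ℕ} {M : Model d p} {𝒳 : Set (Euc p)} {Ω : Type*} [MeasurableSpace Ω]
  {μ : Measure Ω} {θs : Euc d}

/-- The law of large numbers, uniformly over a bounded parameter space. -/
theorem Samples.uniform_deviation_whp [IsProbabilityMeasure μ] (S : M.Samples μ)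
    (hset : M.Setting 𝒳) (hbdd : Bornology.IsBounded M.Θ) {nt : ℕ → Ω → ℕ}
    (hnt : S.IndependentSize nt) {η : ℝ} (hη : 0 < η) :
    WithHighProb μ (fun k => {ω | ∀ θ ∈ M.Θ,
      |S.empRisk k (nt k ω) ω θ - M.synRisk k (nt k ω) θ| ≤ η}) := by
  obtain ⟨r, hr⟩ := hbdd.exists_norm_le
  obtain ⟨K₀, hK₀⟩ := hset.bound_loss r
  set K := max K₀ 1
  have hKpos : 0 < K := lt_of_lt_of_le one_pos (le_max_right _ _)
  have hK : ∀ θ ∈ M.Θ, ∀ x ∈ 𝒳, ∀ y, ‖M.gradLoss θ y x‖ ≤ K := fun θ hθ x hx y =>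
    (hK₀ θ hθ (hr θ hθ) x hx y).2.1.trans (le_max_left _ _)
  have htb : TotallyBounded M.Θ := hbdd.isCompact_closure.totallyBounded.subset subset_closure
  -- Both risks are `K`-Lipschitz, so a mesh `η / (3K)` costs `η/3` for each, and the last `η/3` is
  -- the deviation on the net. The net does not depend on `k`.
  obtain ⟨t, htΘ, htfin, hcov⟩ := Metric.finite_approx_of_totallyBounded htb (η / (3 * K))
    (by positivity)
  have hpt : ∀ θ' ∈ htfin.toFinset, WithHighProb μ (fun k => {ω |
      ‖S.empMean k (nt k ω) ω (fun y x => M.ℓ θ' x y)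
        - M.popMean k (nt k ω) (fun y x => M.ℓ θ' x y)‖ ≤ η / 3}) := fun θ' hθ' => by
    obtain ⟨K', hK'⟩ := hset.loss_observable (htΘ (htfin.mem_toFinset.1 hθ'))
    exact S.deviation_whp hset hK' hnt (by positivity)
  refine ((WithHighProb.forall_finset _ hpt).inter
    (WithHighProb.of_ae (S.ae_inSupport hset))).mono (Eventually.of_forall fun k ω hω θ hθ => ?_)
  obtain ⟨hω1, hω2⟩ := hω
  obtain ⟨θ', hθ', hball⟩ := Set.mem_iUnion₂.1 (hcov hθ)
  have hdist : K * ‖θ - θ'‖ ≤ η / 3 := by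
    have h1 : ‖θ - θ'‖ < η / (3 * K) := by simpa [dist_eq_norm] using hball
    calc K * ‖θ - θ'‖ ≤ K * (η / (3 * K)) := by gcongr
      _ = η / 3 := by field_simp
  have h1 := abs_sub_le_of_hasGradientAt hset.convex
    (fun t ht => S.hasGradientAt_empRisk hset hω2 k (nt k ω) ht)
    (fun t ht => S.norm_empMean_le hset hω2 k (nt k ω) (hK t ht)) (htΘ hθ') hθ
  have h2 := abs_sub_le_of_hasGradientAt hset.convex
    (fun t ht => hset.hasGradientAt_synRisk k (nt k ω) ht)
    (fun t ht => hset.norm_popMean_le k (nt k ω) (hK t ht)) (htΘ hθ') hθ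
  have h3 : |S.empRisk k (nt k ω) ω θ' - M.synRisk k (nt k ω) θ'| ≤ η / 3 :=
    hω1 θ' (htfin.mem_toFinset.2 hθ')
  rw [abs_le] at *
  constructor <;> linarith [h1.1, h1.2, h2.1, h2.2, h3.1, h3.2]

/-- Strong convexity of the synthetic risk. -/
theorem RegularAt.synRisk_lower_bound {lam Lam L C : ℝ} {k m : ℕ} {θt : Euc d}
    (hreg : M.RegularAt θs lam Lam L C k m θt) (hset : M.Setting 𝒳) {θ θ' : Euc d}
    (hθ : θ ∈ M.Θ) (hθ' : θ' ∈ M.Θ) :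
    M.synRisk k m θ + inner ℝ (M.popMean k m (M.gradLoss θ)) (θ' - θ) + lam / 2 * ‖θ' - θ‖ ^ 2 ≤
      M.synRisk k m θ' := by
  refine quadratic_lower_bound (H := fun t => M.popMean k m (M.hessLoss t)) hset.convex
    (fun t ht => hset.hasGradientAt_synRisk k m ht)
    (fun t ht => hset.hasFDerivAt_popMean_gradLoss k m ht) (fun t ht v => ?_) hθ hθ'
  have := hreg.hess_ge t ht v
  rwa [hset.hess_synRisk k m ht] at this

/-- Strong convexity at `θs`, minimality of `θt` and Cauchy–Schwarz. A vanishing bias thus forces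
`θt` towards `θs`. -/
theorem RegularAt.lam_le {lam Lam L C : ℝ} {k m : ℕ} {θt : Euc d}
    (hreg : M.RegularAt θs lam Lam L C k m θt) (hset : M.Setting 𝒳) (hθs : θs ∈ M.Θ) :
    lam / 2 * ‖θt - θs‖ ≤ ‖M.popMean k m (M.gradLoss θs)‖ := by
  have h1 := hreg.synRisk_lower_bound hset hθs hreg.mem
  have h2 := hreg.isMin θs hθs
  have h3 := abs_le.1 (abs_real_inner_le_norm (M.popMean k m (M.gradLoss θs)) (θt - θs))
  rcases (norm_nonneg (θt - θs)).eq_or_lt with h0 | h0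
  · rw [← h0]; simp
  · refine le_of_mul_le_mul_right ?_ h0
    nlinarith [h3.1]

theorem inner_clm_ge {d : ℕ} (A : Euc d →L[ℝ] Euc d) {c : ℝ} (hA : ‖A‖ ≤ c) (v : Euc d) :
    -(c * ‖v‖ ^ 2) ≤ inner ℝ (A v) v := by
  have h1 := abs_le.1 (abs_real_inner_le_norm (A v) v)
  have h2 : ‖A v‖ * ‖v‖ ≤ c * ‖v‖ * ‖v‖ := by
    gcongr
    exact A.le_of_opNorm_le hA v
  nlinarith [h1.1]

/-- Strong convexity of the empirical risk in a neighbourhood of a point at which its Hessian is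
close to that of the synthetic risk. -/
theorem Samples.empRisk_lower_bound (S : M.Samples μ) (hset : M.Setting 𝒳) {ω : Ω}
    (hω : S.InSupport 𝒳 ω) {k m : ℕ} {lam Lam L C : ℝ} {θt : Euc d}
    (hreg : M.RegularAt θs lam Lam L C k m θt) (hθs : θs ∈ M.Θ) {δ : ℝ} (hδ : 0 < δ)
    (hball : Metric.ball θs δ ⊆ M.Θ)
    (hunif : ∀ θ ∈ Metric.ball θs δ, ∀ x ∈ 𝒳, ∀ y,
      ‖M.hessLoss θ y x - M.hessLoss θs y x‖ ≤ lam / 4)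
    (hdev : ‖S.empMean k m ω (M.hessLoss θs) - M.popMean k m (M.hessLoss θs)‖ ≤ lam / 4)
    {θ : Euc d} (hθ : θ ∈ Metric.ball θs δ) :
    S.empRisk k m ω θs + inner ℝ (S.empMean k m ω (M.gradLoss θs)) (θ - θs)
      + lam / 4 * ‖θ - θs‖ ^ 2 ≤ S.empRisk k m ω θ := by
  -- Of the curvature `lam`, sampling at `θs` costs `lam/4` and moving from `θs` to `t` another
  -- `lam/4`, leaving `lam/2`. The modulus of continuity is deterministic, so the Hessian need only
  -- concentrate at the single point `θs`.
  have h := quadratic_lower_bound (H := fun t => S.empMean k m ω (M.hessLoss t))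
    (f := S.empRisk k m ω) (c := lam / 2) (convex_ball θs δ)
    (fun t ht => S.hasGradientAt_empRisk hset hω k m (hball ht))
    (fun t ht => S.hasFDerivAt_empMean_gradLoss hset hω k m (hball ht)) (fun t ht v => ?_)
    (Metric.mem_ball_self hδ) hθ
  · rwa [show lam / 2 / 2 = lam / 4 by ring] at h
  · have h1 := hreg.hess_ge θs hθs v
    rw [hset.hess_synRisk k m hθs] at h1
    have h2 := inner_clm_ge _ hdev v
    have h3 := inner_clm_ge _ (S.norm_empMean_le hset hω k m (hunif t ht)) v
    rw [S.empMean_sub] at h3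
    simp only [_root_.sub_apply, inner_sub_left] at h2 h3
    linarith

theorem Setting.hasGradientAt_risk (hset : M.Setting 𝒳) {θ : Euc d} (hθ : θ ∈ M.Θ) :
    HasGradientAt M.risk ((1 / 2 : ℝ) • ∫ x, M.gradLoss θ 0 x ∂M.P₀
      + (1 / 2 : ℝ) • ∫ x, M.gradLoss θ 1 x ∂M.P₁) θ := by
  have := hset.prob₀
  have := hset.prob₁
  have h0 := (hset.classRisk_calculus _ hset.support₀ 0 hθ).2.2.1
  have h1 := (hset.classRisk_calculus _ hset.support₁ 1 hθ).2.2.1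
  have h := hasGradientAt_combination h0 h1 h1 (1 / 2) (1 / 2) 0
  convert! h using 1
  · ext t
    simp [risk]
  · simp

theorem BalancedMinimizer.gradient_eq_zero (hmin : M.BalancedMinimizer θs)
    (hset : M.Setting 𝒳) : (1 / 2 : ℝ) • ∫ x, M.gradLoss θs 0 x ∂M.P₀
      + (1 / 2 : ℝ) • ∫ x, M.gradLoss θs 1 x ∂M.P₁ = 0 :=
  HasGradientAt.eq_zero_of_isMinOn (hset.hasGradientAt_risk hmin.mem)
    (hset.isOpen.mem_nhds hmin.mem) hmin.isMin

/-- Quadratic upper bound on the excess risk near the minimizer. -/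
theorem BalancedMinimizer.excess_le (hmin : M.BalancedMinimizer θs) (hset : M.Setting 𝒳) {δ K : ℝ}
    (hδ : 0 < δ) (hball : Metric.ball θs δ ⊆ M.Θ)
    (hK : ∀ θ ∈ Metric.ball θs δ, ∀ x ∈ 𝒳, ∀ y, ‖M.hessLoss θ y x‖ ≤ K) {θ : Euc d}
    (hθ : θ ∈ Metric.ball θs δ) : M.risk θ - M.risk θs ≤ K / 2 * ‖θ - θs‖ ^ 2 := by
  have := hset.prob₀
  have := hset.prob₁
  have hgrad : ∀ t ∈ M.Θ, HasGradientAt (fun t => -M.risk t)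
      (-((1 / 2 : ℝ) • ∫ x, M.gradLoss t 0 x ∂M.P₀
        + (1 / 2 : ℝ) • ∫ x, M.gradLoss t 1 x ∂M.P₁)) t := fun t ht => by
    rw [hasGradientAt_iff_hasFDerivAt, map_neg]
    exact (hset.hasGradientAt_risk ht).hasFDerivAt.neg
  have hhess : ∀ t ∈ M.Θ, HasFDerivAt (fun t => -((1 / 2 : ℝ) • ∫ x, M.gradLoss t 0 x ∂M.P₀
        + (1 / 2 : ℝ) • ∫ x, M.gradLoss t 1 x ∂M.P₁))
      (-((1 / 2 : ℝ) • ∫ x, M.hessLoss t 0 x ∂M.P₀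
        + (1 / 2 : ℝ) • ∫ x, M.hessLoss t 1 x ∂M.P₁)) t := fun t ht => by
    have h := (((hset.classRisk_calculus _ hset.support₀ 0 ht).2.2.2.const_smul (1 / 2 : ℝ)).add
      ((hset.classRisk_calculus _ hset.support₁ 1 ht).2.2.2.const_smul (1 / 2 : ℝ))).neg
    refine h.congr_of_eventuallyEq ?_
    filter_upwards [hset.isOpen.mem_nhds ht] with u hu
    simp only [Pi.neg_apply, Pi.add_apply, Pi.smul_apply]
    rw [(hset.classRisk_calculus _ hset.support₀ 0 hu).2.2.1.gradient,
      (hset.classRisk_calculus _ hset.support₁ 1 hu).2.2.1.gradient]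
  -- An upper bound on the Hessian of the risk is a lower bound `-K` for its negative.
  have h := quadratic_lower_bound (c := -K) (convex_ball θs δ) (fun t ht => hgrad t (hball ht))
    (fun t ht => hhess t (hball ht)) (fun t ht v => ?_) (Metric.mem_ball_self hδ) hθ
  · rw [hmin.gradient_eq_zero hset] at h
    simp only [neg_zero, inner_zero_left] at h
    linarith
  · have hn : ‖-((1 / 2 : ℝ) • ∫ x, M.hessLoss t 0 x ∂M.P₀
        + (1 / 2 : ℝ) • ∫ x, M.hessLoss t 1 x ∂M.P₁)‖ ≤ K := by
      rw [norm_neg]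
      refine (norm_add_le _ _).trans ?_
      rw [norm_smul, norm_smul]
      have h0 := Setting.integral_norm_le hset.support₀ (f := M.hessLoss t 0)
        (fun x hx => hK t ht x hx 0)
      have h1 := Setting.integral_norm_le hset.support₁ (f := M.hessLoss t 1)
        (fun x hx => hK t ht x hx 1)
      norm_num
      linarith
    have := inner_clm_ge _ hn v
    linarith

theorem Samples.convexOn_empRisk (S : M.Samples μ) (hset : M.Setting 𝒳)
    (hconv : ∀ x ∈ 𝒳, ∀ y, ConvexOn ℝ M.Θ (fun θ => M.ℓ θ x y)) {ω : Ω}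
    (hω : S.InSupport 𝒳 ω) (k m : ℕ) : ConvexOn ℝ M.Θ (S.empRisk k m ω) := by
  have hsum : ∀ (n : ℕ) (z : ℕ → Euc p) (y : Fin 2), (∀ i, z i ∈ 𝒳) →
      ConvexOn ℝ M.Θ (fun θ => ∑ i ∈ Finset.range n, M.ℓ θ (z i) y) := by
    intro n z y hz
    induction n with
    | zero => simpa using convexOn_const 0 hset.convex
    | succ n ih =>
      simp only [Finset.sum_range_succ]
      exact ih.add (hconv _ (hz n) y)
  have := (hset.total_pos k m).le
  exact (((hsum _ _ 0 fun i => (hω k i).1).add (hsum _ _ 1 fun i => (hω k i).2.1)).add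
    (hsum _ _ 1 fun i => (hω k i).2.2)).smul (by positivity : 0 ≤ 1 / M.total k m)

/-- A minimizer of a convex function stays in a ball around a point where the gradient is small, if
the function is strongly convex there. -/
theorem norm_sub_lt_of_convexOn {d : ℕ} {Θ : Set (Euc d)} {f : Euc d → ℝ} (hf : ConvexOn ℝ Θ f)
    {θs θh g : Euc d} {lam δ : ℝ} (hδ : 0 < δ) (hθs : θs ∈ Θ) (hθh : θh ∈ Θ) (hle : f θh ≤ f θs)
    (hlow : ∀ θ ∈ Metric.ball θs δ, f θs + inner ℝ g (θ - θs) + lam / 4 * ‖θ - θs‖ ^ 2 ≤ f θ)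
    (hg : ‖g‖ < lam * δ / 8) : ‖θh - θs‖ < δ := by
  by_contra! hge
  set r := ‖θh - θs‖ with hr
  have hrpos : 0 < r := hδ.trans_le hge
  -- The segment point at distance `δ/2` has value at most `f θs` by convexity, so the lower bound
  -- there gives `lam δ² / 16 ≤ ‖g‖ δ / 2`, contradicting `hg`.
  set t := δ / 2 / r with ht
  have ht0 : 0 ≤ t := by positivity
  have ht1 : t ≤ 1 := by
    rw [ht, div_le_one hrpos]; linarith
  set θ := θs + t • (θh - θs) with hθ
  have hdist : ‖θ - θs‖ = δ / 2 := by
    rw [hθ, add_sub_cancel_left, norm_smul, Real.norm_of_nonneg ht0, ht, ← hr,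
      div_mul_cancel₀ _ hrpos.ne']
  have h1 := hlow θ (by rw [Metric.mem_ball, dist_eq_norm, hdist]; linarith)
  have h2 : f θ ≤ f θs := by
    have h3 := hf.2 hθs hθh (sub_nonneg.2 ht1) ht0 (by ring)
    have h4 : (1 - t) • θs + t • θh = θ := by
      rw [hθ, smul_sub, sub_smul, one_smul]; abel
    rw [h4] at h3
    simp only [smul_eq_mul] at h3
    nlinarith
  have h3 := abs_le.1 (abs_real_inner_le_norm g (θ - θs))
  rw [hdist] at h1 h3
  nlinarith [h3.1]

/-- With high probability the excess risk is comparable to the squared empirical gradient at the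
balanced minimizer, as soon as the bias of that gradient vanishes. -/
theorem Samples.excess_comparable [IsProbabilityMeasure μ] (S : M.Samples μ)
    (hset : M.Setting 𝒳) (hmin : M.BalancedMinimizer θs) {nt : ℕ → Ω → ℕ} {θhat : ℕ → Ω → Euc d}
    (hnt : S.IndependentSize nt) (hreg : M.Regular μ θs nt) (herm : S.IsERM nt θhat)
    (hbias : ∀ η : ℝ, 0 < η →
      WithHighProb μ (fun k => {ω | ‖M.popMean k (nt k ω) (M.gradLoss θs)‖ ≤ η})) :
    ∃ c C : ℝ, 0 < c ∧ 0 < C ∧ WithHighProb μ (fun k => {ω |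
      c * ‖S.empMean k (nt k ω) ω (M.gradLoss θs)‖ ^ 2 ≤ M.risk (θhat k ω) - M.risk θs ∧
      M.risk (θhat k ω) - M.risk θs ≤
        C * ‖S.empMean k (nt k ω) ω (M.gradLoss θs)‖ ^ 2}) := by
  obtain ⟨lam, Lam, L, C, hlam, hregw⟩ := hreg
  obtain ⟨Lg, hLg, hgrow⟩ := hmin.growth
  obtain ⟨r0, hr0, hr0sub⟩ := Metric.isOpen_iff.1 hset.isOpen θs hmin.mem
  obtain ⟨K₀, hK₀⟩ := hset.bound_loss (‖θs‖ + r0)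
  set K := max K₀ 1
  have hKpos : 0 < K := lt_of_lt_of_le one_pos (le_max_right _ _)
  obtain ⟨δ₁, hδ₁, hunif₁⟩ := hset.hess_uniform (‖θs‖ + r0) (lam / 4) (by positivity)
  set δ := min r0 δ₁
  have hδ : 0 < δ := lt_min hr0 hδ₁
  have hball : Metric.ball θs δ ⊆ M.Θ := (Metric.ball_subset_ball (min_le_left _ _)).trans hr0sub
  have hnorm : ∀ t ∈ Metric.ball θs δ, ‖t‖ ≤ ‖θs‖ + r0 := fun t ht => by
    have h1 : ‖t - θs‖ < δ := by simpa [dist_eq_norm] using ht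
    have h2 := norm_add_le θs (t - θs)
    rw [add_sub_cancel] at h2
    linarith [min_le_left r0 δ₁]
  have hK : ∀ θ ∈ Metric.ball θs δ, ∀ x ∈ 𝒳, ∀ y, ‖M.hessLoss θ y x‖ ≤ K := fun θ hθ x hx y =>
    (hK₀ θ (hball hθ) (hnorm θ hθ) x hx y).2.2.trans (le_max_left _ _)
  have hunif : ∀ θ ∈ Metric.ball θs δ, ∀ x ∈ 𝒳, ∀ y,
      ‖M.hessLoss θ y x - M.hessLoss θs y x‖ ≤ lam / 4 := fun θ hθ x hx y => by
    refine (hunif₁ θ (hball hθ) θs hmin.mem (hnorm θ hθ)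
      (hnorm θs (Metric.mem_ball_self hδ)) ?_ x hx y).le
    have h1 : ‖θ - θs‖ < δ := by simpa [dist_eq_norm] using hθ
    exact h1.trans_le (min_le_right _ _)
  obtain ⟨Kg, hKg⟩ := hset.gradLoss_observable hmin.mem
  obtain ⟨Kh, hKh⟩ := hset.hessLoss_observable hmin.mem
  -- This gives `‖g‖ ≤ lam δ / 16`, below the threshold `lam δ / 8` of the convex case. In the
  -- bounded case, a minimizer at distance `r ≥ δ` would have synthetic excess at least `lam r² / 2
  -- - η r`, more than the `lam δ² / 8` allowed by two uniform deviations.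
  set η := lam * δ / 32 with hη
  have hηpos : 0 < η := by positivity
  -- Stated as an implication, the event has high probability whether or not `Θ` is bounded.
  have hclose : WithHighProb μ (fun k => {ω | Bornology.IsBounded M.Θ →
      ∀ θ ∈ M.Θ, |S.empRisk k (nt k ω) ω θ - M.synRisk k (nt k ω) θ| ≤ lam * δ ^ 2 / 16}) := by
    by_cases hbdd : Bornology.IsBounded M.Θ
    · refine (S.uniform_deviation_whp hset hbdd hnt (η := lam * δ ^ 2 / 16) (by positivity)).mono
        (Eventually.of_forall fun k ω hω _ => hω)
    · exact (WithHighProb.of_ae (P := fun _ => True) (ae_of_all _ fun _ => trivial)).mono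
        (Eventually.of_forall fun k ω _ hb => absurd hb hbdd)
  refine ⟨Lg / K ^ 2, K * (4 / lam) ^ 2, by positivity, by positivity, ?_⟩
  refine ((((((WithHighProb.of_ae (S.ae_inSupport hset)).inter hregw).inter herm).inter
    (hbias η hηpos)).inter (S.deviation_whp hset hKg hnt hηpos)).inter
    ((S.deviation_whp hset hKh hnt (t := lam / 4) (by positivity)).inter hclose)).mono
    (Eventually.of_forall fun k ω hω => ?_)
  obtain ⟨⟨⟨⟨⟨hsupp, ⟨θt, hregat⟩⟩, hmem, hminim⟩, hb⟩, hdevg⟩, hdevh, hunifdev⟩ := hω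
  set m := nt k ω
  set θh := θhat k ω
  set g := S.empMean k m ω (M.gradLoss θs) with hg
  have hb' : ‖M.popMean k m (M.gradLoss θs)‖ ≤ η := hb
  have hdevg' : ‖g - M.popMean k m (M.gradLoss θs)‖ ≤ η := hdevg
  have hgle : ‖g‖ ≤ 2 * η := by
    have := norm_add_le (g - M.popMean k m (M.gradLoss θs)) (M.popMean k m (M.gradLoss θs))
    rw [sub_add_cancel] at this
    linarith
  have hlow : ∀ θ ∈ Metric.ball θs δ, S.empRisk k m ω θs + inner ℝ g (θ - θs)
      + lam / 4 * ‖θ - θs‖ ^ 2 ≤ S.empRisk k m ω θ := fun θ hθ =>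
    S.empRisk_lower_bound hset hsupp hregat hmin.mem hδ hball hunif hdevh hθ
  have hless : S.empRisk k m ω θh ≤ S.empRisk k m ω θs := hminim θs hmin.mem
  have hnear : ‖θh - θs‖ < δ := by
    rcases hset.bounded_or_convex with hbdd | hconv
    · by_contra! hge
      have h1 := abs_le.1 (hunifdev hbdd θh hmem)
      have h2 := abs_le.1 (hunifdev hbdd θs hmin.mem)
      have h3 := hregat.synRisk_lower_bound hset hmin.mem hmem
      have h4 := abs_le.1 (abs_real_inner_le_norm (M.popMean k m (M.gradLoss θs)) (θh - θs))
      have h5 : ‖M.popMean k m (M.gradLoss θs)‖ * ‖θh - θs‖ ≤ η * ‖θh - θs‖ := by gcongr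
      have h6 : lam * δ ^ 2 ≤ lam * ‖θh - θs‖ ^ 2 := by gcongr
      have h7 : lam * δ * ‖θh - θs‖ ≤ lam * ‖θh - θs‖ * ‖θh - θs‖ := by gcongr
      have h8 : 0 < lam * δ ^ 2 := by positivity
      have h9 : 0 ≤ lam * δ * ‖θh - θs‖ := by positivity
      rw [hη] at h5
      linarith [h1.1, h1.2, h2.1, h2.2, h4.1]
    · refine norm_sub_lt_of_convexOn (S.convexOn_empRisk hset hconv hsupp k m) hδ hmin.mem hmem
        hless hlow ?_
      have : 0 < lam * δ := by positivity
      linarith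
  have hθhball : θh ∈ Metric.ball θs δ := by rwa [Metric.mem_ball, dist_eq_norm]
  -- Minimality in the strongly convex ball gives `lam/4 ‖θh - θs‖² ≤ ‖g‖ ‖θh - θs‖`.
  have hup : ‖θh - θs‖ ≤ 4 / lam * ‖g‖ := by
    have h1 := hlow θh hθhball
    have h2 := abs_le.1 (abs_real_inner_le_norm g (θh - θs))
    rw [div_mul_eq_mul_div, le_div_iff₀ hlam]
    rcases (norm_nonneg (θh - θs)).eq_or_lt with h0 | h0
    · rw [← h0]; simp
    · refine le_of_mul_le_mul_right ?_ h0
      nlinarith [h2.1]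
  -- The empirical gradient vanishes at `θh`, interior because `Θ` is open, and is `K`-Lipschitz on
  -- the ball.
  have hlo : ‖g‖ ≤ K * ‖θh - θs‖ := by
    have hzero : S.empMean k m ω (M.gradLoss θh) = 0 :=
      HasGradientAt.eq_zero_of_isMinOn (S.hasGradientAt_empRisk hset hsupp k m hmem)
        (hset.isOpen.mem_nhds hmem) hminim
    have h1 := (convex_ball θs δ).norm_image_sub_le_of_norm_hasFDerivWithin_le
      (f := fun t => S.empMean k m ω (M.gradLoss t))
      (fun t ht => (S.hasFDerivAt_empMean_gradLoss hset hsupp k m (hball ht)).hasFDerivWithinAt)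
      (fun t ht => S.norm_empMean_le hset hsupp k m (hK t ht)) hθhball (Metric.mem_ball_self hδ)
    simp only [hzero, sub_zero] at h1
    rwa [norm_sub_rev] at h1
  constructor
  · refine le_trans ?_ (hgrow θh hmem)
    calc Lg / K ^ 2 * ‖g‖ ^ 2 ≤ Lg / K ^ 2 * (K * ‖θh - θs‖) ^ 2 := by gcongr
      _ = Lg * ‖θh - θs‖ ^ 2 := by field_simp
  · refine (hmin.excess_le hset hδ hball hK hθhball).trans ?_
    calc K / 2 * ‖θh - θs‖ ^ 2 ≤ K * (4 / lam * ‖g‖) ^ 2 := by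
          gcongr
          linarith
      _ = K * (4 / lam) ^ 2 * ‖g‖ ^ 2 := by ring

end Model

/-! ### Calculus of stochastic orders. -/

section StochasticOrder

variable {Ω : Type*} [MeasurableSpace Ω] {μ : Measure Ω}

theorem WithHighProb.of_forall_le {A : ℕ → Set Ω}
    (h : ∀ ε : ℝ, 0 < ε → ∀ᶠ k in atTop, μ (A k)ᶜ ≤ ENNReal.ofReal ε) : WithHighProb μ A := by
  refine ENNReal.tendsto_nhds_zero.2 fun ε hε => ?_
  by_cases htop : ε = ⊤
  · simp [htop]
  · filter_upwards [h ε.toReal (ENNReal.toReal_pos hε.ne' htop)] with k hk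
    rwa [ENNReal.ofReal_toReal htop] at hk

theorem measure_le_ofReal_of_subset_union {A B C : Set Ω} {ε : ℝ} (hε : 0 < ε) (h : A ⊆ B ∪ C)
    (hB : μ B ≤ ENNReal.ofReal (ε / 2)) (hC : μ C ≤ ENNReal.ofReal (ε / 2)) :
    μ A ≤ ENNReal.ofReal ε := by
  calc μ A ≤ μ B + μ C := (measure_mono h).trans (measure_union_le _ _)
    _ ≤ ENNReal.ofReal (ε / 2) + ENNReal.ofReal (ε / 2) := add_le_add hB hC
    _ = ENNReal.ofReal ε := by
      rw [← ENNReal.ofReal_add (by positivity) (by positivity), add_halves]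

/-- A quantity comparable to the square of a nonnegative one has the squared stochastic order. -/
theorem IsThetaP.of_comparable_sq {x G : ℕ → Ω → ℝ} {a : ℕ → ℝ} (ha : ∀ k, 0 ≤ a k)
    (hG : ∀ k ω, 0 ≤ G k ω) {c C : ℝ} (hc : 0 < c) (hC : 0 < C)
    (hx : WithHighProb μ (fun k => {ω | c * G k ω ^ 2 ≤ x k ω ∧ x k ω ≤ C * G k ω ^ 2}))
    (h : IsThetaP μ G a) : IsThetaP μ x (fun k => a k ^ 2) := by
  constructor
  · intro ε hε
    obtain ⟨D, hD, hev⟩ := h.1 (ε / 2) (by positivity)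
    refine ⟨C * D ^ 2, by positivity, ?_⟩
    filter_upwards [hev, hx.eventually_le (half_pos hε)] with k h1 h2
    refine measure_le_ofReal_of_subset_union hε (fun ω hω => ?_) h1 h2
    by_contra hne
    simp only [Set.mem_union, Set.mem_compl_iff, Set.mem_ofPred_eq, not_or, not_not, not_lt] at hne
    obtain ⟨h3, h4, h5⟩ := hne
    have hω' : C * D ^ 2 * a k ^ 2 < |x k ω| := hω
    rw [abs_of_nonneg (hG k ω)] at h3
    rw [abs_of_nonneg (le_trans (by positivity) h4)] at hω'
    have : C * G k ω ^ 2 ≤ C * (D * a k) ^ 2 := by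
      have := hG k ω
      gcongr
    nlinarith
  · intro ε hε
    obtain ⟨D, hD, hev⟩ := h.2 (ε / 2) (by positivity)
    refine ⟨c * D ^ 2, by positivity, ?_⟩
    filter_upwards [hev, hx.eventually_le (half_pos hε)] with k h1 h2
    refine measure_le_ofReal_of_subset_union hε (fun ω hω => ?_) h1 h2
    by_contra hne
    simp only [Set.mem_union, Set.mem_compl_iff, Set.mem_ofPred_eq, not_or, not_not, not_lt] at hne
    obtain ⟨h3, h4, h5⟩ := hne
    have hω' : |x k ω| < c * D ^ 2 * a k ^ 2 := hω
    rw [abs_of_nonneg (hG k ω)] at h3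
    rw [abs_of_nonneg (le_trans (by positivity) h4)] at hω'
    have : c * (D * a k) ^ 2 ≤ c * G k ω ^ 2 := by
      have := ha k
      gcongr
    nlinarith

end StochasticOrder

/-! ### Nondegeneracy and bias of the gradient at the balanced minimizer. -/

/-- A Loewner lower bound on a covariance operator bounds the variances of projections. -/
theorem LoewnerGE.le_variance {d p : ℕ} {P : Measure (Euc p)} {g : Euc p → Euc d} {c : ℝ}
    (h : LoewnerGE (covOp P g) c) (hg : Integrable g P) (v : Euc d) :
    c * ‖v‖ ^ 2 ≤ Var[fun x => inner ℝ v (g x); P] := by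
  refine (h v).trans ?_
  by_cases hint : Integrable (fun x => InnerProductSpace.rankOne ℝ (g x - ∫ z, g z ∂P)
      (g x - ∫ z, g z ∂P)) P
  · have hgv : AEMeasurable (fun x => inner ℝ v (g x)) P :=
      (hg.const_inner v).aestronglyMeasurable.aemeasurable
    rw [covOp, ContinuousLinearMap.integral_apply hint, real_inner_comm,
      ← integral_inner (hint.apply_continuousLinearMap v) v, variance_eq_integral hgv,
      integral_inner hg v]
    refine le_of_eq (integral_congr_ae (ae_of_all _ fun x => ?_))
    simp only [InnerProductSpace.rankOne_apply, inner_smul_right, inner_sub_left, inner_sub_right]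
    rw [real_inner_comm v (g x), real_inner_comm v]
    ring
  -- Without integrability the covariance operator defaults to zero, and a variance is nonnegative.
  · rw [covOp, integral_undef hint]
    simp [variance_nonneg]

/-- The bias of the augmented gradient, in terms of the deviation of the synthetic size from the
bias-cancelling one. -/
theorem norm_bias_le {d : ℕ} (g h : Euc d) (hg : g ≠ 0) {n₀ n₁ m U V : ℝ} (hn₀ : 0 < n₀)
    (hn₁ : 0 ≤ n₁) (hm : 0 ≤ m)
    (heq : m * (1 - 2 * (‖h‖ / ‖g‖) * Real.cos (InnerProductGeometry.angle g h) + V) =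
      n₀ - n₁ + U) :
    ‖(n₀ / (n₀ + n₁ + m) - 1 / 2) • g + (m / (n₀ + n₁ + m)) • h‖ ≤
      ‖g‖ / 2 * (|V| + |U| / n₀) + ‖h‖ * Real.sin (InnerProductGeometry.angle g h) := by
  have hg' : 0 < ‖g‖ := norm_pos_iff.2 hg
  set N := n₀ + n₁ + m with hN
  have hNpos : 0 < N := by positivity
  set c := Real.cos (InnerProductGeometry.angle g h) with hc
  set s := Real.sin (InnerProductGeometry.angle g h) with hs
  have hs0 : 0 ≤ s := InnerProductGeometry.sin_angle_nonneg g h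
  have hsc : s ^ 2 + c ^ 2 = 1 := Real.sin_sq_add_cos_sq _
  set r := ‖h‖ / ‖g‖ with hr
  have hrg : r * ‖g‖ = ‖h‖ := div_mul_cancel₀ _ hg'.ne'
  have hinner : c * (‖g‖ * ‖h‖) = inner ℝ g h := InnerProductGeometry.cos_angle_mul_norm_mul_norm g h
  -- The component of `h` orthogonal to `g`, of norm `‖h‖ sin ∠`.
  set w := h - (r * c) • g with hw
  have hwn : ‖w‖ = ‖h‖ * s := by
    have h1 : ‖w‖ ^ 2 = (‖h‖ * s) ^ 2 := by
      rw [hw, norm_sub_sq_real, inner_smul_right, real_inner_comm, ← hinner, norm_smul,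
        Real.norm_eq_abs, mul_pow, sq_abs, ← hrg]
      linear_combination (-(r ^ 2 * ‖g‖ ^ 2)) * hsc
    exact (pow_left_inj₀ (norm_nonneg _) (by positivity) two_ne_zero).1 h1
  have hdecomp : (n₀ / N - 1 / 2) • g + (m / N) • h =
      ((m * V - U) / (2 * N)) • g + (m / N) • w := by
    -- The total coefficient of `g` is `(n₀ - n₁ - m (1 - 2 r c)) / (2N)`. The prescribed size is
    -- its root when `U = V = 0`; in general `m V - U` is what remains.
    have hα : (m * V - U) / (2 * N) = n₀ / N - 1 / 2 + m / N * (r * c) := by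
      field_simp
      rw [hN]
      linear_combination heq
    rw [hα, hw, smul_sub, add_smul, smul_smul]
    abel
  rw [hdecomp]
  have hmN : m / N ≤ 1 := (div_le_one hNpos).2 (by rw [hN]; linarith)
  have hα : |(m * V - U) / (2 * N)| ≤ 1 / 2 * (|V| + |U| / n₀) := by
    rw [abs_div, abs_of_pos (by positivity : 0 < 2 * N), div_le_iff₀ (by positivity)]
    have h1 : |m * V - U| ≤ m * |V| + |U| := by
      have := abs_sub (m * V) U
      rwa [abs_mul, abs_of_nonneg hm] at this
    have h2 : m * |V| ≤ N * |V| := by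
      gcongr; rw [hN]; linarith
    have h3 : |U| ≤ N * (|U| / n₀) := by
      rw [mul_div_assoc', le_div_iff₀ hn₀, mul_comm]
      gcongr; rw [hN]; linarith
    linarith
  refine (norm_add_le _ _).trans ?_
  rw [norm_smul, norm_smul, hwn, Real.norm_eq_abs, Real.norm_of_nonneg (by positivity)]
  have h1 : |(m * V - U) / (2 * N)| * ‖g‖ ≤ 1 / 2 * (|V| + |U| / n₀) * ‖g‖ := by gcongr
  have h2 : m / N * (‖h‖ * s) ≤ 1 * (‖h‖ * s) := by gcongr
  linarith

namespace Model

variable {d p : ℕ} {M : Model d p} {𝒳 : Set (Euc p)} {Ω : Type*} [MeasurableSpace Ω]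
  {μ : Measure Ω} {θs : Euc d}

/-- The weights sum to one and the balanced gradient vanishes at `θs`; subtracting it from the
pooled gradient leaves only the two sources of bias, imbalance and generator error. -/
theorem BalancedMinimizer.popMean_gradLoss_eq (hmin : M.BalancedMinimizer θs)
    (hset : M.Setting 𝒳) (k m : ℕ) : M.popMean k m (M.gradLoss θs) =
      (M.π₀ k m - 1 / 2) • gradient M.φ θs + M.πsyn k m • gradient (M.ψ k) θs := by
  have := hset.prob₀
  have := hset.prob₁
  have := hset.probSyn k
  have h0 := (hset.classRisk_calculus _ hset.support₀ 0 hmin.mem).2.2.1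
  have h1 := (hset.classRisk_calculus _ hset.support₁ 1 hmin.mem).2.2.1
  have h2 := (hset.classRisk_calculus _ (hset.supportSyn k) 1 hmin.mem).2.2.1
  have hφ : HasGradientAt M.φ (∫ x, M.gradLoss θs 0 x ∂M.P₀ - ∫ x, M.gradLoss θs 1 x ∂M.P₁) θs := by
    rw [hasGradientAt_iff_hasFDerivAt, map_sub]
    exact h0.hasFDerivAt.sub h1.hasFDerivAt
  have hψ : HasGradientAt (M.ψ k)
      (∫ x, M.gradLoss θs 1 x ∂M.Psyn k - ∫ x, M.gradLoss θs 1 x ∂M.P₁) θs := by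
    rw [hasGradientAt_iff_hasFDerivAt, map_sub]
    exact h2.hasFDerivAt.sub h1.hasFDerivAt
  rw [hφ.gradient, hψ.gradient, popMean]
  have hz := hmin.gradient_eq_zero hset
  have hπ : M.π₁ k m = 1 - M.π₀ k m - M.πsyn k m := by linarith [hset.π_sum k m]
  rw [hπ, ← sub_eq_zero, ← hz]
  module

/-- At the balanced minimizer, the loss gradient of the majority class is not degenerate. -/
theorem Setting.variance_gradLoss_ne_zero [IsProbabilityMeasure μ] (hset : M.Setting 𝒳)
    (hθs : θs ∈ M.Θ) {nt : ℕ → Ω → ℕ} (hreg : M.Regular μ θs nt)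
    (hbias : ∀ η : ℝ, 0 < η →
      WithHighProb μ (fun k => {ω | ‖M.popMean k (nt k ω) (M.gradLoss θs)‖ ≤ η}))
    {v : Euc d} (hv : ‖v‖ = 1) : Var[fun x => inner ℝ v (M.gradLoss θs 0 x); M.P₀] ≠ 0 := by
  intro hzero
  have := hset.prob₀
  obtain ⟨lam, Lam, L, C, hlam, hregw⟩ := hreg
  obtain ⟨r0, hr0, hr0sub⟩ := Metric.isOpen_iff.1 hset.isOpen θs hθs
  obtain ⟨K₀, hK₀⟩ := hset.bound_loss (‖θs‖ + r0)
  set K := max K₀ 1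
  have hKpos : 0 < K := lt_of_lt_of_le one_pos (le_max_right _ _)
  -- If `‖θt - θs‖ ≤ τ`, then `θt` is in the ball and the two gradients differ by at most `√lam /
  -- 2`. A projection constant at `θs` would then have variance at most `lam/4` at `θt`, against the
  -- lower bound `lam`.
  set τ := min (r0 / 2) (√lam / (2 * K)) with hτ
  have hτpos : 0 < τ := lt_min (by positivity) (by positivity)
  -- Neither `P₀` nor `θs` varies with `k`, so one good outcome of one experiment suffices.
  obtain ⟨k, ω, ⟨θt, hregat⟩, hb⟩ := (hregw.inter (hbias (lam / 2 * τ) (by positivity))).exists_mem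
  have hb' : ‖M.popMean k (nt k ω) (M.gradLoss θs)‖ ≤ lam / 2 * τ := hb
  have hdist : ‖θt - θs‖ ≤ τ :=
    le_of_mul_le_mul_left ((hregat.lam_le hset hθs).trans hb') (by positivity)
  have hθt : θt ∈ Metric.ball θs r0 := by
    rw [Metric.mem_ball, dist_eq_norm]
    linarith [min_le_left (r0 / 2) (√lam / (2 * K))]
  obtain ⟨K', hK'⟩ := hset.gradLoss_observable hregat.mem
  obtain ⟨K'', hK''⟩ := hset.gradLoss_observable hθs
  have hint := (hK'.integrable hset k).1
  have hints := (hK''.integrable hset k).1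
  have hge : lam ≤ Var[fun x => inner ℝ v (M.gradLoss θt 0 x); M.P₀] := by
    have h1 : LoewnerGE (covOp M.P₀ (M.gradLoss θt 0)) lam := hregat.cov₀_ge
    simpa [hv] using h1.le_variance hint v
  have hL2 : MemLp (fun x => inner ℝ v (M.gradLoss θs 0 x)) 2 M.P₀ := by
    refine MemLp.of_bound (hints.const_inner v).aestronglyMeasurable K'' ?_
    filter_upwards [hset.support₀] with x hx
    refine (norm_inner_le_norm v _).trans ?_
    rw [hv, one_mul]
    exact hK''.bound x hx 0
  have hconst : ∀ᵐ x ∂M.P₀, inner ℝ v (M.gradLoss θs 0 x) =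
      ∫ x, inner ℝ v (M.gradLoss θs 0 x) ∂M.P₀ := by
    have h1 : evariance (fun x => inner ℝ v (M.gradLoss θs 0 x)) M.P₀ = 0 := by
      rw [← hL2.ofReal_variance_eq, hzero, ENNReal.ofReal_zero]
    exact (evariance_eq_zero_iff hL2.aestronglyMeasurable.aemeasurable).1 h1
  set a := ∫ x, inner ℝ v (M.gradLoss θs 0 x) ∂M.P₀
  have hsm : AEStronglyMeasurable (fun x => inner ℝ v (M.gradLoss θt 0 x)) M.P₀ :=
    (hint.const_inner v).aestronglyMeasurable
  have hbound : ∀ᵐ x ∂M.P₀, ((fun x => inner ℝ v (M.gradLoss θt 0 x) - a) ^ 2) x ≤ lam / 4 := by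
    filter_upwards [hset.support₀, hconst] with x hx hxa
    have h1 : ‖M.gradLoss θt 0 x - M.gradLoss θs 0 x‖ ≤ K * ‖θt - θs‖ := by
      refine (convex_ball θs r0).norm_image_sub_le_of_norm_hasFDerivWithin_le
        (f := fun t => M.gradLoss t 0 x)
        (fun t ht => (hset.hasFDerivAt_gradLoss (hr0sub ht) hx 0).hasFDerivWithinAt)
        (fun t ht => ?_) (Metric.mem_ball_self hr0) hθt
      refine (hK₀ t (hr0sub ht) ?_ x hx 0).2.2.trans (le_max_left _ _)
      have h1 : ‖t - θs‖ < r0 := by simpa [dist_eq_norm] using ht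
      have h2 := norm_add_le θs (t - θs)
      rw [add_sub_cancel] at h2
      linarith
    have h2 : |inner ℝ v (M.gradLoss θt 0 x) - a| ≤ √lam / 2 := by
      rw [← hxa, ← inner_sub_right]
      refine (abs_real_inner_le_norm _ _).trans ?_
      rw [hv, one_mul]
      calc _ ≤ K * ‖θt - θs‖ := h1
        _ ≤ K * (√lam / (2 * K)) := by
          gcongr
          exact hdist.trans (min_le_right _ _)
        _ = √lam / 2 := by field_simp
    calc (inner ℝ v (M.gradLoss θt 0 x) - a) ^ 2 ≤ (√lam / 2) ^ 2 :=
          sq_le_sq' (by linarith [(abs_le.1 h2).1]) (abs_le.1 h2).2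
      _ = lam / 4 := by
          rw [div_pow, Real.sq_sqrt hlam.le]; norm_num
  have hle : Var[fun x => inner ℝ v (M.gradLoss θt 0 x); M.P₀] ≤ lam / 4 := by
    rw [← variance_sub_const hsm a]
    refine (variance_le_expectation_sq (hsm.sub aestronglyMeasurable_const)).trans ?_
    have := integral_mono_of_nonneg (ae_of_all _ fun x => sq_nonneg _)
      (integrable_const (lam / 4)) hbound
    simpa using this
  linarith

/-- A bias-cancelling synthetic size makes the bias `O_P(1 / √n₀)` and keeps the total sample size
`O_P(n₀)`. -/
theorem BiasCancelling.bias_tail {nt : ℕ → Ω → ℕ} (hbc : M.BiasCancelling μ θs nt)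
    (hset : M.Setting 𝒳) (hmin : M.BalancedMinimizer θs) (hasym : M.LocalAsymmetry θs)
    (hreal : M.RealisticGenerator θs) (halign : M.Aligned θs) {ε : ℝ} (hε : 0 < ε) :
    ∃ D : ℝ, 0 < D ∧ ∀ᶠ k in atTop, μ {ω |
      ‖M.popMean k (nt k ω) (M.gradLoss θs)‖ ≤ D * (1 / √(M.n₀ k : ℝ)) ∧
      M.total k (nt k ω) ≤ D * M.n₀ k}ᶜ ≤ ENNReal.ofReal ε := by
  obtain ⟨U, V, hU, hV, hW⟩ := hbc
  obtain ⟨a, ha, hag⟩ := hasym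
  have hg0 : 0 < ‖gradient M.φ θs‖ := ha.trans_le hag
  obtain ⟨Cu, hCu, hUev⟩ := hU (ε / 2 / 2) (by positivity)
  obtain ⟨Cv, hCv, hVev⟩ := hV (ε / 2 / 2) (by positivity)
  obtain ⟨Cs, hCs, hsin⟩ := halign.exists_pos
  have hsqrt : Tendsto (fun k => √(M.n₀ k : ℝ)) atTop atTop :=
    Real.tendsto_sqrt_atTop.comp hset.n₀_tendsto
  have hV0 : ∀ᶠ k in atTop, Cv * (1 / √(M.n₀ k : ℝ)) < 1 / 4 := by
    have : Tendsto (fun k => Cv * (1 / √(M.n₀ k : ℝ))) atTop (𝓝 (Cv * 0)) :=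
      (hsqrt.const_div_atTop 1).const_mul Cv
    rw [mul_zero] at this
    exact this.eventually (gt_mem_nhds (by norm_num))
  have hr0 : ∀ᶠ k in atTop, 2 * (‖gradient (M.ψ k) θs‖ / ‖gradient M.φ θs‖) < 1 / 4 := by
    have : Tendsto (fun k => 2 * (‖gradient (M.ψ k) θs‖ / ‖gradient M.φ θs‖)) atTop
        (𝓝 (2 * (0 / ‖gradient M.φ θs‖))) := (hreal.2.div_const _).const_mul 2
    rw [zero_div, mul_zero] at this
    exact this.eventually (gt_mem_nhds (by norm_num))
  -- The first two summands bound the bias; the last bounds the total size, since the denominator is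
  -- eventually at least `1/2` and so `m ≤ 2 (n₀ - n₁ + U)`.
  refine ⟨‖gradient M.φ θs‖ / 2 * (Cv + Cu) + Cs + (4 + 2 * Cu), by positivity, ?_⟩
  filter_upwards [hUev, hVev, hsin.bound, hV0, hr0, hW.eventually_le (half_pos hε)] with
    k hUk hVk hsk hV0k hr0k hWk
  refine measure_le_ofReal_of_subset_union hε
    (B := {ω | Cu * √(M.n₀ k : ℝ) < |U k ω|} ∪ {ω | Cv * (1 / √(M.n₀ k : ℝ)) < |V k ω|})
    (fun ω hω => ?_)
    (measure_le_ofReal_of_subset_union (half_pos hε) subset_rfl hUk hVk) hWk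
  by_contra hne
  simp only [Set.mem_union, Set.mem_compl_iff, Set.mem_ofPred_eq, not_or, not_not, not_lt] at hne
  obtain ⟨⟨hUω, hVω⟩, hWω⟩ := hne
  refine hω ?_
  set n := (M.n₀ k : ℝ) with hn
  have hn1 : 1 ≤ n := by
    have := hset.n₀_pos k
    rw [hn]; exact_mod_cast this
  have hnpos : 0 < n := by linarith
  have hs : 0 < √n := Real.sqrt_pos.2 hnpos
  have hsn : √n * √n = n := Real.mul_self_sqrt hnpos.le
  have hsle : √n ≤ n := by
    have : 1 ≤ √n := Real.one_le_sqrt.2 hn1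
    nlinarith
  have hn₁ : (0 : ℝ) ≤ M.n₁ k := Nat.cast_nonneg _
  have hn₁lt : (M.n₁ k : ℝ) ≤ n := by
    rw [hn]; exact_mod_cast (hset.imbalanced k).le
  have hm : (0 : ℝ) ≤ nt k ω := Nat.cast_nonneg _
  set h := gradient (M.ψ k) θs
  set g := gradient M.φ θs
  set r := ‖h‖ / ‖g‖ with hr
  have hrnn : 0 ≤ r := by positivity
  have hcos := abs_le.1 (Real.abs_cos_le_one (M.biasAngle θs k))
  have hVabs := abs_le.1 (hVω.trans hV0k.le)
  have hden : 1 / 2 ≤ 1 - 2 * r * Real.cos (M.biasAngle θs k) + V k ω := by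
    have : 2 * r * Real.cos (M.biasAngle θs k) ≤ 2 * r * 1 := by
      gcongr; exact hcos.2
    linarith [hVabs.1]
  have heq : (nt k ω : ℝ) * (1 - 2 * r * Real.cos (M.biasAngle θs k) + V k ω) =
      n - M.n₁ k + U k ω := by
    rw [hWω]
    exact div_mul_cancel₀ _ (by linarith)
  constructor
  · rw [hmin.popMean_gradLoss_eq hset]
    refine (norm_bias_le g h (norm_pos_iff.1 hg0) hnpos hn₁ hm heq).trans ?_
    have h1 : |U k ω| / n ≤ Cu * (1 / √n) := by
      rw [div_le_iff₀ hnpos]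
      calc |U k ω| ≤ Cu * √n := hUω
        _ = Cu * (1 / √n) * n := by
          nth_rewrite 3 [← hsn]
          field_simp
    have h2 : ‖h‖ * Real.sin (InnerProductGeometry.angle g h) ≤ Cs * (1 / √n) := by
      -- The alignment bound has `‖h‖` in a denominator, so `h = 0` is treated apart.
      rcases (norm_nonneg h).eq_or_lt with h0 | h0
      · rw [← h0, zero_mul]; positivity
      · have h3 : Real.sin (InnerProductGeometry.angle g h) ≤ Cs * (1 / (‖h‖ * √n)) := by
          have h4 : ‖(1 : ℝ) / (‖h‖ * √n)‖ = 1 / (‖h‖ * √n) :=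
            Real.norm_of_nonneg (by positivity)
          rw [h4] at hsk
          exact (le_abs_self _).trans hsk
        calc _ ≤ ‖h‖ * (Cs * (1 / (‖h‖ * √n))) := by gcongr
          _ = Cs * (1 / √n) := by field_simp
    have h3 : ‖g‖ / 2 * (|V k ω| + |U k ω| / n) ≤
        ‖g‖ / 2 * (Cv * (1 / √n) + Cu * (1 / √n)) := by gcongr
    have h4 : 0 ≤ (4 + 2 * Cu) * (1 / √n) := by positivity
    linarith
  · have h1 : (nt k ω : ℝ) * (1 / 2) ≤ n - M.n₁ k + U k ω := by
      rw [← heq]; gcongr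
    have h2 : U k ω ≤ Cu * n := (le_abs_self _).trans (hUω.trans (by gcongr))
    have h3 : 0 ≤ (‖g‖ / 2 * (Cv + Cu) + Cs) * n := by positivity
    unfold total
    rw [← hn]
    linarith

end Model

theorem one_div_sqrt_sq (n : ℕ) : (1 / √(n : ℝ)) ^ 2 = 1 / (n : ℝ) := by
  rw [div_pow, one_pow, Real.sq_sqrt (Nat.cast_nonneg n)]

/-! ### Excess risk at the two synthetic sizes. -/

namespace Model

variable {d p : ℕ} {M : Model d p} {𝒳 : Set (Euc p)} {Ω : Type*} [MeasurableSpace Ω]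
  {μ : Measure Ω} {θs : Euc d}

/-- The excess risk with a bias-cancelling synthetic size. -/
theorem Samples.excess_biasCancelling [IsProbabilityMeasure μ] (S : M.Samples μ)
    (hset : M.Setting 𝒳) (hmin : M.BalancedMinimizer θs) (hasym : M.LocalAsymmetry θs)
    (hreal : M.RealisticGenerator θs) (halign : M.Aligned θs) {nt : ℕ → Ω → ℕ}
    {θhat : ℕ → Ω → Euc d} (hnt : S.IndependentSize nt) (hreg : M.Regular μ θs nt)
    (hbc : M.BiasCancelling μ θs nt) (herm : S.IsERM nt θhat) :
    IsThetaP μ (fun k ω => M.risk (θhat k ω) - M.risk θs) (fun k => 1 / (M.n₀ k : ℝ)) := by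
  have hbias : ∀ η : ℝ, 0 < η →
      WithHighProb μ (fun k => {ω | ‖M.popMean k (nt k ω) (M.gradLoss θs)‖ ≤ η}) := by
    intro η hη
    refine WithHighProb.of_forall_le fun ε hε => ?_
    obtain ⟨D, -, hev⟩ := hbc.bias_tail hset hmin hasym hreal halign hε
    have hlim : Tendsto (fun k => D * (1 / √(M.n₀ k : ℝ))) atTop (𝓝 (D * 0)) :=
      ((Real.tendsto_sqrt_atTop.comp hset.n₀_tendsto).const_div_atTop 1).const_mul D
    rw [mul_zero] at hlim
    filter_upwards [hev, hlim.eventually (gt_mem_nhds hη)] with k hk hk2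
    exact (measure_mono (Set.compl_subset_compl.2 fun ω hω => hω.1.trans hk2.le)).trans hk
  obtain ⟨c, C, hc, hC, hcomp⟩ := S.excess_comparable hset hmin hnt hreg herm hbias
  obtain ⟨K, hK⟩ := hset.gradLoss_observable hmin.mem
  have hg0 : gradient M.φ θs ≠ 0 := by
    obtain ⟨a, ha, hag⟩ := hasym
    exact norm_pos_iff.1 (ha.trans_le hag)
  -- Any unit vector will do; local asymmetry rules out dimension zero.
  obtain ⟨v, hv⟩ : ∃ v : Euc d, ‖v‖ = 1 := ⟨_, norm_smul_inv_norm (𝕜 := ℝ) hg0⟩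
  have hvar := hset.variance_gradLoss_ne_zero hmin.mem hreg hbias hv
  have hθ : IsThetaP μ (fun k ω => ‖S.empMean k (nt k ω) ω (M.gradLoss θs)‖)
      (fun k => 1 / √(M.n₀ k : ℝ)) := by
    constructor
    · intro ε hε
      obtain ⟨D, hD, hev⟩ := hbc.bias_tail hset hmin hasym hreal halign (half_pos hε)
      obtain ⟨D', hD', hev'⟩ := S.deviation_isBigOP hset hK hnt (ε / 2) (half_pos hε)
      refine ⟨D + D', by positivity, ?_⟩
      filter_upwards [hev, hev'] with k hk hk'
      refine measure_le_ofReal_of_subset_union hε (fun ω hω => ?_) hk hk'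
      by_contra hne
      simp only [Set.mem_union, Set.mem_compl_iff, Set.mem_ofPred_eq, not_or, not_not, not_lt,
        abs_norm] at hne hω
      have := norm_add_le (M.popMean k (nt k ω) (M.gradLoss θs))
        (S.empMean k (nt k ω) ω (M.gradLoss θs) - M.popMean k (nt k ω) (M.gradLoss θs))
      rw [add_sub_cancel] at this
      linarith [hne.1.1, hne.2]
    · intro ε hε
      obtain ⟨D, hD, hev⟩ := hbc.bias_tail hset hmin hasym hreal halign (half_pos hε)
      -- Anti-concentration concerns the uncentred sum, at scale `√n₀`. Dividing by a total size of
      -- at most `D n₀` gives the scale `1/√n₀` for the mean.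
      obtain ⟨c₀, hc₀, hev'⟩ := S.exists_anticoncentration hset (hK.clm (innerSL ℝ v)) hvar hnt
        (half_pos hε)
      refine ⟨c₀ / D, by positivity, ?_⟩
      filter_upwards [hev, hev'] with k hk hk'
      refine measure_le_ofReal_of_subset_union hε (fun ω hω => ?_) hk hk'
      by_contra hne
      simp only [Set.mem_union, Set.mem_compl_iff, Set.mem_ofPred_eq, not_or, not_not, not_le,
        abs_norm] at hne hω
      obtain ⟨⟨-, hN⟩, hlt⟩ := hne
      rw [S.empMean_clm] at hlt
      have h1 : |innerSL ℝ v (S.empMean k (nt k ω) ω (M.gradLoss θs))| ≤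
          c₀ / D * (1 / √(M.n₀ k : ℝ)) := by
        refine le_trans ?_ hω.le
        simpa [hv] using abs_real_inner_le_norm v (S.empMean k (nt k ω) ω (M.gradLoss θs))
      have hn0 : (0 : ℝ) < M.n₀ k := by exact_mod_cast hset.n₀_pos k
      have hs : 0 < √(M.n₀ k : ℝ) := Real.sqrt_pos.2 hn0
      have h2 : M.total k (nt k ω) * |innerSL ℝ v (S.empMean k (nt k ω) ω (M.gradLoss θs))| ≤
          D * M.n₀ k * (c₀ / D * (1 / √(M.n₀ k : ℝ))) := by gcongr
      have h3 : D * M.n₀ k * (c₀ / D * (1 / √(M.n₀ k : ℝ))) = c₀ * √(M.n₀ k : ℝ) := by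
        nth_rewrite 1 [← Real.mul_self_sqrt hn0.le]
        field_simp
      linarith
  have := IsThetaP.of_comparable_sq (fun k => by positivity) (fun k ω => norm_nonneg _) hc hC
    hcomp hθ
  simpa only [one_div_sqrt_sq] using this

/-- The excess risk with the balancing synthetic size `n₀ - n₁`. -/
theorem Samples.excess_balancing [IsProbabilityMeasure μ] (S : M.Samples μ)
    (hset : M.Setting 𝒳) (hmin : M.BalancedMinimizer θs) (hreal : M.RealisticGenerator θs)
    {θhat : ℕ → Ω → Euc d} {ρ : ℝ} (hρ : ρ < 1)
    (himb : ∀ᶠ k in atTop, (M.n₁ k : ℝ) ≤ ρ * (M.n₀ k : ℝ))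
    (hreg : M.Regular μ θs (fun k _ => M.n₀ k - M.n₁ k))
    (herm : S.IsERM (fun k _ => M.n₀ k - M.n₁ k) θhat) :
    IsThetaP μ (fun k ω => M.risk (θhat k ω) - M.risk θs)
      (fun k => ‖gradient (M.ψ k) θs‖ ^ 2) := by
  have hnt : S.IndependentSize (fun k _ => M.n₀ k - M.n₁ k) := fun k =>
    ⟨measurable_const, indepFun_const_left _ _⟩
  -- Balancing makes `π₀ = 1/2`, which removes `∇φ` and leaves the synthetic share of `∇ψ`.
  have hb : ∀ k, ‖M.popMean k (M.n₀ k - M.n₁ k) (M.gradLoss θs)‖ =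
      ((M.n₀ k : ℝ) - M.n₁ k) / (2 * M.n₀ k) * ‖gradient (M.ψ k) θs‖ := fun k => by
    have hn0 : (0 : ℝ) < M.n₀ k := by exact_mod_cast hset.n₀_pos k
    have hle : (M.n₁ k : ℝ) ≤ M.n₀ k := by exact_mod_cast (hset.imbalanced k).le
    have hcast : ((M.n₀ k - M.n₁ k : ℕ) : ℝ) = (M.n₀ k : ℝ) - M.n₁ k :=
      Nat.cast_sub (hset.imbalanced k).le
    have htot : M.total k (M.n₀ k - M.n₁ k) = 2 * M.n₀ k := by
      unfold total
      rw [hcast]; ring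
    have hπ : M.π₀ k (M.n₀ k - M.n₁ k) - 1 / 2 = 0 := by
      unfold π₀
      rw [htot]
      field_simp
      norm_num
    rw [hmin.popMean_gradLoss_eq hset, hπ, zero_smul, zero_add, norm_smul, πsyn, htot, hcast,
      Real.norm_of_nonneg (div_nonneg (by linarith) (by positivity))]
  have hb_le : ∀ k, ‖M.popMean k (M.n₀ k - M.n₁ k) (M.gradLoss θs)‖ ≤ ‖gradient (M.ψ k) θs‖ := by
    intro k
    have hn0 : (0 : ℝ) < M.n₀ k := by exact_mod_cast hset.n₀_pos k
    have hn1 : (0 : ℝ) ≤ M.n₁ k := Nat.cast_nonneg _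
    rw [hb]
    refine mul_le_of_le_one_left (norm_nonneg _) ((div_le_one (by positivity)).2 (by linarith))
  have hbias : ∀ η : ℝ, 0 < η → WithHighProb μ
      (fun k => {_ω : Ω | ‖M.popMean k (M.n₀ k - M.n₁ k) (M.gradLoss θs)‖ ≤ η}) := by
    intro η hη
    refine WithHighProb.of_eventually ?_
    filter_upwards [hreal.2.eventually (gt_mem_nhds hη)] with k hk
    exact (hb_le k).trans hk.le
  obtain ⟨c, C, hc, hC, hcomp⟩ := S.excess_comparable hset hmin hnt hreg herm hbias
  obtain ⟨K, hK⟩ := hset.gradLoss_observable hmin.mem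
  refine IsThetaP.of_comparable_sq (fun k => norm_nonneg _) (fun k ω => norm_nonneg _) hc hC
    hcomp ⟨fun ε hε => ?_, fun ε hε => ?_⟩
  · obtain ⟨D, hD, hev⟩ := S.deviation_isBigOP hset hK hnt ε hε
    refine ⟨1 + D, by positivity, ?_⟩
    filter_upwards [hev, hreal.1.bound one_pos] with k hk hk2
    refine (measure_mono fun ω hω => ?_).trans hk
    simp only [Set.mem_ofPred_eq, abs_norm] at hω ⊢
    rw [norm_norm, one_mul, Real.norm_of_nonneg (by positivity)] at hk2
    have h1 := norm_add_le (M.popMean k (M.n₀ k - M.n₁ k) (M.gradLoss θs))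
      (S.empMean k (M.n₀ k - M.n₁ k) ω (M.gradLoss θs)
        - M.popMean k (M.n₀ k - M.n₁ k) (M.gradLoss θs))
    rw [add_sub_cancel] at h1
    have h2 : D * (1 / √(M.n₀ k : ℝ)) ≤ D * ‖gradient (M.ψ k) θs‖ := by gcongr
    linarith [hb_le k]
  · obtain ⟨D, hD, hev⟩ := S.deviation_isBigOP hset hK hnt ε hε
    have hρ' : 0 < 1 - ρ := by linarith
    -- The bias is at least `(1 - ρ)/2 ‖∇ψ‖`; outside an event of probability at most `ε`, the noise
    -- is eventually at most half of that.
    refine ⟨(1 - ρ) / 4, by positivity, ?_⟩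
    filter_upwards [hev, hreal.1.bound (show 0 < (1 - ρ) / 4 / D by positivity), himb] with
      k hk hk2 hk3
    refine (measure_mono fun ω hω => ?_).trans hk
    simp only [Set.mem_ofPred_eq, abs_norm] at hω ⊢
    rw [norm_norm, Real.norm_of_nonneg (by positivity), div_mul_eq_mul_div, le_div_iff₀ hD] at hk2
    have hn0 : (0 : ℝ) < M.n₀ k := by exact_mod_cast hset.n₀_pos k
    have h1 := norm_sub_norm_le (M.popMean k (M.n₀ k - M.n₁ k) (M.gradLoss θs))
      (S.empMean k (M.n₀ k - M.n₁ k) ω (M.gradLoss θs))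
    rw [norm_sub_rev] at h1
    have h2 : (1 - ρ) / 2 * ‖gradient (M.ψ k) θs‖ ≤
        ‖M.popMean k (M.n₀ k - M.n₁ k) (M.gradLoss θs)‖ := by
      rw [hb]
      refine mul_le_mul_of_nonneg_right ?_ (norm_nonneg _)
      rw [div_le_div_iff₀ two_pos (by positivity)]
      linarith
    linarith

end Model

end SynAug

end

theorem theorem4 {d p : ℕ} (M : SynAug.Model d p) (𝒳 : Set (SynAug.Euc p)) (θs : SynAug.Euc d)
    {Ω : Type*} [MeasurableSpace Ω] (μ : Measure Ω) [IsProbabilityMeasure μ] (S : M.Samples μ)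
    (hset : M.Setting 𝒳) (hmin : M.BalancedMinimizer θs)
    (hasym : M.LocalAsymmetry θs)
    (hcurv : ∃ C : ℝ, ∀ k, ‖SynAug.hess (M.ψ k) θs‖ ≤ C)
    (hreal : M.RealisticGenerator θs) (halign : M.Aligned θs) :
    (∀ (nt : ℕ → Ω → ℕ) (θhat : ℕ → Ω → SynAug.Euc d),
      S.IndependentSize nt → M.Regular μ θs nt → M.BiasCancelling μ θs nt → S.IsERM nt θhat →
        SynAug.IsThetaP μ (fun k ω => M.risk (θhat k ω) - M.risk θs)
          (fun k => 1 / (M.n₀ k : ℝ))) ∧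
    (∀ (θhat : ℕ → Ω → SynAug.Euc d),
      (∃ ρ : ℝ, ρ < 1 ∧ ∀ᶠ k in atTop, (M.n₁ k : ℝ) ≤ ρ * (M.n₀ k : ℝ)) →
      M.Regular μ θs (fun k _ => M.n₀ k - M.n₁ k) →
      S.IsERM (fun k _ => M.n₀ k - M.n₁ k) θhat →
        SynAug.IsThetaP μ (fun k ω => M.risk (θhat k ω) - M.risk θs)
          (fun k => ‖gradient (M.ψ k) θs‖ ^ 2)) ∧
    (fun k => 1 / (M.n₀ k : ℝ)) =o[atTop] (fun k => ‖gradient (M.ψ k) θs‖ ^ 2) := by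
  refine ⟨fun nt θhat hnt hreg hbc herm =>
    S.excess_biasCancelling hset hmin hasym hreal halign hnt hreg hbc herm, ?_, ?_⟩
  · rintro θhat ⟨ρ, hρ, himb⟩ hreg herm
    exact S.excess_balancing hset hmin hreal hρ himb hreg herm
  · simpa only [SynAug.one_div_sqrt_sq] using hreal.1.pow (n := 2) two_pos
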